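/- **Setting.** Let $\mathbb K=\mathbb R$ or $\mathbb C$, let $V$ be a $\mathbb K$-vector space with basis $(x^i)_{i\in I}$, and let $y_i\in V^*=\mathrm{Hom}(V,\mathbb K)$ be the coordinate functions. Put $\deg x^i=1$, $\deg\hbar=2$, let $\mathbb K[[V,\hbar]]$ be the completion of $\mathbb K[V,\hbar]$ with respect to the degree, and let $\widehat{\mathcal W}_\hbar(V)$ be the completion, for pointwise convergence on $\mathbb K[[V,\hbar]]$, of the algebra of differential operators generated by $\hbar$, $x^i$, $\hbar\partial_i$; it is graded by $\deg x^i=\deg\hbar\partial_i=1$, $\deg \hbar=2$. Give $V^*$ the topology of pointwise convergence on $V$ ($V$ and $\mathbb K$ discrete). A *quantum Airy structure* on $V$ is a continuous linear map $L:V^*\to\widehat{\mathcal W}_\hbar(V)$ such that the left ideal $\mathfrak L$ generated by $L(V^*)$ satisfies $[\mathfrak L,\mathfrak L]\subseteq\hbar\,\mathfrak L$, and $L(y_i)^{\le1}=\hbar\partial_i$ for all $i$. It is *quadratic* if $2$ is the least positive integer $n$ with $L(V^*)\subseteq\widehat{\mathcal W}_\hbar(V)^{\le n}$, and *subalgebraic*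 if $[L(V^*),L(V^*)]\subseteq\hbar\,L(V^*)$. **Proposition.** Let $V$ have basis $x^0,x^1,x^2,\dots$. The operators $$b_k=\sqrt\hbar\,\partial_k,\qquad b_{-k}=\tfrac1{\sqrt\hbar}\,k\,x^k\quad(k\ge1),\qquad b_0=\sqrt\hbar\,\partial_0$$ represent the Heisenberg algebra: $[b_m,b_n]=m\,\delta_{m,-n}$. The same holds, in the variables $x^1,x^2,\dots$, if $b_0$ is replaced by $0$. For an integer $N\ge-1$ and $i\ge0$ the operators $$H_i=\hbar\partial_i+\frac\hbar2\sum_{k\in\mathbb Z}{:}b_k\,b_{i+N-1-k}{:}$$ (in ${:}\;{:}$ modes with negative index stand to the left) belong to $\widehat{\mathcal W}_\hbar(V)$ and satisfy $$[H_i,H_j]=\hbar\,(i-j)\,H_{i+j+N-1}\qquad(\ast)$$ for all $i,j\ge0$ if $N\ge0$, and for all $i,j\ge1$ if $N\ge-1$ (when $i+j+N-1$ is negative, $i=j$ and $(\ast)$ reads $0=0$). Write $\delta_{i\le R}=1$ if $i\le R$ and $0$ otherwise. 1. Let $N\ge0$ and let $D_0,\dots,D_{N-1}\in\mathbb K$ be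 arbitrary. There is a unique continuous linear map $H:V^*\to\widehat{\mathcal W}_\hbar(V)$ with $H(y_i)=H_i+\hbar D_i\,\delta_{i\le N-1}$ for all $i\ge0$. It is a quadratic, subalgebraic quantum Airy structure, and the $H(y_i)$, $i\ge0$, satisfy $(\ast)$. 2. Let $N\ge-1$ and let $C_0,D_0,\dots,D_{N+1}\in\mathbb K$ be arbitrary. There is a unique continuous linear map $H:V^*\to\widehat{\mathcal W}_\hbar(V)$ with $H(y_i)=H_i+\hbar D_i\,\delta_{i\le N+1}$ for all $i\ge1$ and $H(y_0)=\hbar\partial_0+\frac{\hbar^2}2C_0\,\partial_0^2+\hbar D_0$. It is a quadratic, subalgebraic quantum Airy structure, the $H(y_i)$, $i\ge1$, satisfy $(\ast)$, and $[H(y_0),H(y_i)]=0$ for all $i\ge1$. 3. Let $N\ge-1$, let $D_1,\dots,D_{N+1}\in\mathbb K$ be arbitrary, and let $V_{red}\subset V$ be the span of $x^1,x^2,\dots$. There is a unique continuous linear map $H:V_{red}^*\to\widehat{\mathcal W}_\hbar(V_{red})$ with $H(y_i)=H_i\big|_{b_0=0}+\hbar D_i\,\delta_{i\le N+1}$ for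 all $i\ge1$. It is a quadratic, subalgebraic quantum Airy structure, and the $H(y_i)$, $i\ge1$, satisfy $(\ast)$. -/

import Mathlib

namespace Airy

noncomputable section

/-! ### Formal series in the variables `x^i` and in half-integral powers of `ħ` -/

/-- Index of the monomial `ħ^(p/2) x^α`: the pair `(p, α)`. -/
abbrev Mon (ι : Type*) := ℤ × (ι →₀ ℕ)

/-- All formal series `∑ c_{p,α} ħ^(p/2) x^α`, given by their coefficients. This is only an ambient
space in which `√ħ` is invertible, so that the bosonic modes make sense as operators. -/
abbrev Raw (K ι : Type*) := Mon ι → K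

/-- The degree, `deg x^i = 1`, `deg ħ = 2` (hence `deg √ħ = 1`). -/
def deg {ι : Type*} (e : Mon ι) : ℤ := e.1 + (e.2.degree : ℤ)

section Operators

variable (K : Type*) [Field K] {ι : Type*}

/-- Multiplication by `ħ^(n/2)`. -/
def hpow (n : ℤ) : Module.End K (Raw K ι) where
  toFun f := fun e => f (e.1 - n, e.2)
  map_add' _ _ := rfl
  map_smul' _ _ := rfl

/-- Multiplication by the variable `x^i`. -/
def mulX (i : ι) : Module.End K (Raw K ι) where
  toFun f := fun e => if e.2 i = 0 then 0 else f (e.1, e.2 - Finsupp.single i 1)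
  map_add' f g := by
    funext e
    by_cases h : e.2 i = 0 <;> simp [h]
  map_smul' c f := by
    funext e
    by_cases h : e.2 i = 0 <;> simp [h]

/-- The partial derivative `∂_i = ∂/∂x^i`. -/
def pd (i : ι) : Module.End K (Raw K ι) where
  toFun f := fun e => ((e.2 i : K) + 1) * f (e.1, e.2 + Finsupp.single i 1)
  map_add' f g := by
    funext e
    simp [mul_add]
  map_smul' c f := by
    funext e
    simp [mul_left_comm]

end Operators

/-! ### The space `K[[V, ħ]]`, where `V` has basis `(x^i)_{i ∈ ι}` -/

section Series

variable (K : Type*) [Field K] (ι : Type*)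

/-- `K[[V, ħ]]`, the completion of the polynomial ring `K[V, ħ]` with respect to the degree: series
in non-negative integral powers of `ħ` and of the `x^i`, with finitely many terms in each degree. -/
def PS : Submodule K (Raw K ι) where
  carrier := {f | (∀ e, f e ≠ 0 → 0 ≤ e.1 ∧ Even e.1) ∧ ∀ d : ℤ, {e | deg e = d ∧ f e ≠ 0}.Finite}
  zero_mem' := by simp
  add_mem' := by
    rintro f g ⟨hf, hf'⟩ ⟨hg, hg'⟩
    have key : ∀ e, (f + g) e ≠ 0 → f e ≠ 0 ∨ g e ≠ 0 := by
      intro e he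
      by_contra! h
      exact he (by simp [h.1, h.2])
    refine ⟨fun e he => (key e he).elim (hf e) (hg e), fun d => ?_⟩
    refine ((hf' d).union (hg' d)).subset ?_
    rintro e ⟨hd, he⟩
    exact (key e he).imp (fun h => ⟨hd, h⟩) (fun h => ⟨hd, h⟩)
  smul_mem' := by
    rintro c f ⟨hf, hf'⟩
    have key : ∀ e, (c • f) e ≠ 0 → f e ≠ 0 := by
      intro e he h
      exact he (by simp [h])
    refine ⟨fun e he => hf e (key e he), fun d => (hf' d).subset ?_⟩
    rintro e ⟨hd, he⟩
    exact ⟨hd, key e he⟩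

/-- `K[[V, ħ]]^{≥ n}`: the series all of whose terms have degree at least `n`. These subspaces form
a neighbourhood basis of zero in `K[[V, ħ]]`. -/
def filt (n : ℤ) : Submodule K (PS K ι) where
  carrier := {f | ∀ e, f.1 e ≠ 0 → n ≤ deg e}
  zero_mem' := by simp
  add_mem' := by
    intro f g hf hg e he
    by_cases h : f.1 e = 0
    · by_cases h' : g.1 e = 0
      · exact absurd (by simp [h, h']) he
      · exact hg e h'
    · exact hf e h
  smul_mem' := by
    intro c f hf e he
    refine hf e fun h => he ?_
    simp [h]

variable {K ι}

theorem hpow_mem {f : Raw K ι} (hf : f ∈ PS K ι) : hpow K 2 f ∈ PS K ι := by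
  refine ⟨fun e he => ?_, fun d => ?_⟩
  · obtain ⟨h1, h2⟩ := hf.1 (e.1 - 2, e.2) he
    simp only at h1 h2
    exact ⟨by lia, by simpa [Int.even_sub] using h2⟩
  · refine ((hf.2 (d - 2)).image fun e => (e.1 + 2, e.2)).subset ?_
    rintro e ⟨hd, he⟩
    refine ⟨(e.1 - 2, e.2), ⟨?_, he⟩, by simp⟩
    simp only [deg] at hd ⊢
    lia

theorem mulX_mem (i : ι) {f : Raw K ι} (hf : f ∈ PS K ι) : mulX K i f ∈ PS K ι := by
  have key : ∀ e, mulX K i f e ≠ 0 → e.2 i ≠ 0 ∧ f (e.1, e.2 - Finsupp.single i 1) ≠ 0 := by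
    intro e he
    by_cases h : e.2 i = 0
    · exact absurd (by simp [mulX, h]) he
    · exact ⟨h, by simpa [mulX, h] using he⟩
  refine ⟨fun e he => hf.1 (e.1, e.2 - Finsupp.single i 1) (key e he).2, fun d => ?_⟩
  refine ((hf.2 (d - 1)).image fun e => (e.1, e.2 + Finsupp.single i 1)).subset ?_
  rintro e ⟨hd, he⟩
  obtain ⟨h1, h2⟩ := key e he
  have h3 : e.2 - Finsupp.single i 1 + Finsupp.single i 1 = e.2 :=
    tsub_add_cancel_of_le (by simpa [Finsupp.single_le_iff] using Nat.one_le_iff_ne_zero.2 h1)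
  refine ⟨(e.1, e.2 - Finsupp.single i 1), ⟨?_, h2⟩, by simp [h3]⟩
  have h4 := congrArg Finsupp.degree h3
  simp only [map_add, Finsupp.degree_single] at h4
  simp only [deg] at hd ⊢
  lia

theorem pd_mem (i : ι) {f : Raw K ι} (hf : f ∈ PS K ι) : pd K i f ∈ PS K ι := by
  have key : ∀ e, pd K i f e ≠ 0 → f (e.1, e.2 + Finsupp.single i 1) ≠ 0 := by
    intro e he h
    exact he (by simp [pd, h])
  refine ⟨fun e he => hf.1 (e.1, e.2 + Finsupp.single i 1) (key e he), fun d => ?_⟩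
  refine ((hf.2 (d + 1)).image fun e => (e.1, e.2 - Finsupp.single i 1)).subset ?_
  rintro e ⟨hd, he⟩
  refine ⟨(e.1, e.2 + Finsupp.single i 1), ⟨?_, key e he⟩, by simp⟩
  simp only [deg, map_add, Finsupp.degree_single] at hd ⊢
  push_cast
  lia

variable (K ι)

/-- Multiplication by `ħ` on `K[[V, ħ]]`. -/
def hbar : Module.End K (PS K ι) := (hpow K 2).restrict fun _ => hpow_mem

variable {ι}

/-- Multiplication by `x^i` on `K[[V, ħ]]`. -/
def opX (i : ι) : Module.End K (PS K ι) := (mulX K i).restrict fun _ => mulX_mem i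

/-- The derivative `∂_i` on `K[[V, ħ]]`. -/
def opD (i : ι) : Module.End K (PS K ι) := (pd K i).restrict fun _ => pd_mem i

end Series

/-! ### The completed Weyl algebra -/

section Weyl

variable (K : Type*) [Field K] (ι : Type*)

/-- The algebra of differential operators generated by `ħ`, the `x^i` and the `ħ∂_i`. -/
def weyl : Subalgebra K (Module.End K (PS K ι)) :=
  Algebra.adjoin K ({hbar K ι} ∪ Set.range (opX K) ∪ Set.range fun i => hbar K ι * opD K i)

variable {K ι}

theorem weyl_filt {W : Module.End K (PS K ι)} (hW : W ∈ weyl K ι) (n : ℤ) {f : PS K ι}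
    (hf : f ∈ filt K ι n) : W f ∈ filt K ι n := by
  induction hW using Algebra.adjoin_induction generalizing f with
  | mem W hW =>
    rcases hW with (hW | ⟨i, rfl⟩) | ⟨i, rfl⟩
    · rw [Set.mem_singleton_iff] at hW
      subst hW
      intro e he
      have := hf (e.1 - 2, e.2) he
      simp only [deg] at this ⊢
      lia
    · intro e he
      have he' : mulX K i f.1 e ≠ 0 := he
      by_cases h : e.2 i = 0
      · exact absurd (by simp [mulX, h]) he'
      · have h2 := hf (e.1, e.2 - Finsupp.single i 1) (by simpa [mulX, h] using he')
        have h3 : e.2 - Finsupp.single i 1 + Finsupp.single i 1 = e.2 :=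
          tsub_add_cancel_of_le (by simpa [Finsupp.single_le_iff] using Nat.one_le_iff_ne_zero.2 h)
        have h4 := congrArg Finsupp.degree h3
        simp only [map_add, Finsupp.degree_single] at h4
        simp only [deg] at h2 ⊢
        lia
    · intro e he
      have he' : pd K i f.1 (e.1 - 2, e.2) ≠ 0 := he
      have h2 := hf (e.1 - 2, e.2 + Finsupp.single i 1) fun h => he' (by simp [pd, h])
      simp only [deg, map_add, Finsupp.degree_single] at h2 ⊢
      push_cast at h2
      lia
  | algebraMap r => exact (filt K ι n).smul_mem r hf
  | add S T _ _ hS hT => exact (filt K ι n).add_mem (hS hf) (hT hf)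
  | mul S T _ _ hS hT => exact hS (hT hf)

variable (K ι)

/-- The completed Weyl algebra `Ŵ_ħ(V)`: the closure of the algebra of differential operators for
the topology of pointwise convergence on `K[[V, ħ]]`, i.e. all `T` such that, for all `f_1, …, f_r`
and all `n`, some differential operator agrees with `T` on `f_1, …, f_r` up to terms of degree at
least `n`. (Infinite sums such as `∑_j x^j ħ∂_j`, with finitely many coefficients for each product
of derivatives, lie in this closure, so that it does not matter whether one starts from `weyl` or
also admits such sums before completing.) -/
def What : Subalgebra K (Module.End K (PS K ι)) where
  carrier := {T | ∀ (s : Finset (PS K ι)) (n : ℤ),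
    ∃ W ∈ weyl K ι, ∀ f ∈ s, T f - W f ∈ filt K ι n}
  algebraMap_mem' r s n := ⟨_, (weyl K ι).algebraMap_mem r, fun f _ => by simp⟩
  add_mem' := by
    intro S T hS hT s n
    obtain ⟨W, hW, h⟩ := hS s n
    obtain ⟨W', hW', h'⟩ := hT s n
    refine ⟨W + W', add_mem hW hW', fun f hf => ?_⟩
    have := (filt K ι n).add_mem (h f hf) (h' f hf)
    simpa [add_sub_add_comm] using this
  mul_mem' := by
    classical
    intro S T hS hT s n
    obtain ⟨W', hW', h'⟩ := hT s n
    obtain ⟨W, hW, h⟩ := hS (s.image W') n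
    refine ⟨W * W', mul_mem hW hW', fun f hf => ?_⟩
    obtain ⟨U, hU, hU'⟩ := hS {T f - W' f} n
    have h1 : S (T f - W' f) ∈ filt K ι n := by
      have h3 := (filt K ι n).add_mem (hU' _ (Finset.mem_singleton_self _))
        (weyl_filt hU n (h' f hf))
      rwa [sub_add_cancel] at h3
    have h2 := h (W' f) (Finset.mem_image_of_mem _ hf)
    have := (filt K ι n).add_mem h1 h2
    simpa using this

variable {K ι}

instance : Ring (What K ι) := @Subalgebra.toRing K (Module.End K (PS K ι)) _ _ _ (What K ι)

theorem weyl_le_What : weyl K ι ≤ What K ι := fun W hW _ _ => ⟨W, hW, fun f _ => by simp⟩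

variable (K ι)

/-- `ħ` as an element of `Ŵ_ħ(V)`. -/
def hbarW : What K ι :=
  ⟨hbar K ι, weyl_le_What (Algebra.subset_adjoin (Or.inl (Or.inl rfl)))⟩

variable {K ι}

/-- The part of a series that is homogeneous of degree `d`. -/
def degPart (d : ℤ) (f : PS K ι) : PS K ι :=
  ⟨fun e => if deg e = d then f.1 e else 0, by
    refine ⟨fun e he => f.2.1 e ?_, fun d' => (f.2.2 d').subset ?_⟩
    · intro h
      simp [h] at he
    · rintro e ⟨hd, he⟩
      refine ⟨hd, fun h => ?_⟩
      simp [h] at he⟩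

/-- The component `T^d` of degree `d` of an operator `T`: it sends a series that is homogeneous of
degree `j` to the part of degree `j + d` of its image under `T`, for each `j`. On differential
operators this is the grading with `deg x^i = 1`, `deg ħ∂_i = 1`, `deg ħ = 2`. -/
def degComp (d : ℤ) (T : Module.End K (PS K ι)) : Module.End K (PS K ι) where
  toFun f := ⟨fun e => (T (degPart (deg e - d) f)).1 e, by
    refine ⟨fun e he => (T (degPart (deg e - d) f)).2.1 e he, fun d' => ?_⟩
    refine ((T (degPart (d' - d) f)).2.2 d').subset ?_
    rintro e ⟨rfl, he⟩
    exact ⟨rfl, he⟩⟩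
  map_add' f g := by
    have h : ∀ j, degPart j (f + g) = degPart j f + degPart j g := by
      intro j
      apply Subtype.ext
      funext e
      by_cases h : deg e = j <;> simp [degPart, h]
    apply Subtype.ext
    funext e
    simp [h]
  map_smul' c f := by
    have h : ∀ j, degPart j (c • f) = c • degPart j f := by
      intro j
      apply Subtype.ext
      funext e
      by_cases h : deg e = j <;> simp [degPart, h]
    apply Subtype.ext
    funext e
    simp [h]

/-- `T^{≤ n} = T^0 + T^1 + ⋯ + T^n` (elements of `Ŵ_ħ(V)` have no components of negative degree). -/
def lowPart (n : ℕ) (T : Module.End K (PS K ι)) : Module.End K (PS K ι) :=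
  ∑ d ∈ Finset.range (n + 1), degComp (d : ℤ) T

end Weyl

/-! ### Quantum Airy structures -/

section Structures

variable {K : Type*} [Field K] {ι : Type*}

/-- The dual `V^* = Hom(V, K)` of the vector space `V` with basis `(x^i)_{i ∈ ι}`. -/
abbrev DualV (K : Type*) [Field K] (ι : Type*) := Module.Dual K (ι →₀ K)

/-- The dual set: `y_i` is the `i`-th coordinate function. -/
def y (K : Type*) [Field K] {ι : Type*} (i : ι) : DualV K ι := Finsupp.lapply i

/-- Continuity of a linear map `L : V^* → Ŵ_ħ(V)`, where `V` and `K` are discrete and both sides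
carry the topology of pointwise convergence (on `V` and on `K[[V, ħ]]` respectively). -/
def IsCont (L : DualV K ι →ₗ[K] What K ι) : Prop :=
  ∀ (f : PS K ι) (n : ℤ), ∃ s : Finset (ι →₀ K),
    ∀ φ : DualV K ι, (∀ v ∈ s, φ v = 0) → (L φ).1 f ∈ filt K ι n

/-- The (bosonic) quantum Airy structures on `V`. In a non-commutative ring, `Ideal` means left
ideal. -/
structure IsQuantumAiry (L : DualV K ι →ₗ[K] What K ι) : Prop where
  continuous : IsCont L
  involutive : ∀ a ∈ Ideal.span (Set.range L), ∀ b ∈ Ideal.span (Set.range L),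
    ∃ c ∈ Ideal.span (Set.range L), a * b - b * a = hbarW K ι * c
  linear : ∀ i : ι, lowPart 1 (L (y K i)).1 = hbar K ι * opD K i

/-- `L` has order two: `2` is the least positive `n` with `L(V^*) ⊆ Ŵ_ħ(V)^{≤ n}`. -/
def IsQuadratic (L : DualV K ι →ₗ[K] What K ι) : Prop :=
  IsLeast {n : ℕ | 0 < n ∧ ∀ φ, (L φ).1 = lowPart n (L φ).1} 2

/-- `[L(V^*), L(V^*)] ⊆ ħ · L(V^*)`. -/
def IsSubalgebraic (L : DualV K ι →ₗ[K] What K ι) : Prop :=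
  ∀ φ ψ, ∃ χ, L φ * L ψ - L ψ * L φ = hbarW K ι * L χ

end Structures

/-! ### The free boson -/

section Boson

variable (K : Type*) [Field K]

/-- The bosonic modes `b_k = √ħ ∂_k` for `k ≥ 0` and `b_{-k} = k x^k / √ħ` for `k ≥ 1`, where the
variables are `x^0, x^1, x^2, …`. -/
def boson (k : ℤ) : Module.End K (Raw K ℕ) :=
  if 0 ≤ k then hpow K 1 * pd K k.toNat
  else ((-k : ℤ) : K) • (hpow K (-1) * mulX K (-k).toNat)

/-- The bosonic modes with zero mode set to zero, where the variables are `x^1, x^2, …`. -/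
def bosonRed : ℤ → Module.End K (Raw K ℕ+)
  | 0 => 0
  | Int.ofNat (k + 1) => hpow K 1 * pd K k.succPNat
  | Int.negSucc k => ((k : K) + 1) • (hpow K (-1) * mulX K k.succPNat)

variable {K} {ι : Type*}

/-- The relations `[b_m, b_n] = m δ_{m,-n}` of the Heisenberg algebra. -/
def IsHeisenberg (b : ℤ → Module.End K (Raw K ι)) : Prop :=
  ∀ m n : ℤ, b m * b n - b n * b m = if m = -n then (m : K) • 1 else 0

/-- The normally ordered product `:b_k b_l:` (negative modes on the left). -/
def nord (b : ℤ → Module.End K (Raw K ι)) (k l : ℤ) : Module.End K (Raw K ι) :=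
  if k ≤ l then b k * b l else b l * b k

/-- The Virasoro mode `L_m = (1/2) ∑_{k ∈ ℤ} :b_k b_{m-k}:`. Applied to an element of `K[[V, ħ]]`,
the sum has finitely many nonzero terms in each coefficient. -/
def virasoro (b : ℤ → Module.End K (Raw K ι)) (m : ℤ) (f : Raw K ι) : Raw K ι :=
  fun e => (1 / 2 : K) * ∑ᶠ k : ℤ, nord b k (m - k) f e

/-- `H_i = ħ ∂_i + (ħ/2) ∑_{k ∈ ℤ} :b_k b_{i+N-1-k}:`, where `n` is the value of the index `i`. -/
def hamiltonian (b : ℤ → Module.End K (Raw K ι)) (N : ℤ) (i : ι) (n : ℤ) (f : Raw K ι) :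
    Raw K ι :=
  hpow K 2 (pd K i f) + hpow K 2 (virasoro b (n + N - 1) f)

/-- Truncated constants `D_i δ_{i ≤ R}`. -/
def trunc (D : ℕ → K) (R : ℤ) (i : ℕ) : K := if (i : ℤ) ≤ R then D i else 0

/-- The linear map `L` is continuous with `L(y_i) = P_i` for all `i`, where the operators `P_i` are
given by formulas on formal series. -/
def IsGivenBy (P : ι → Raw K ι → Raw K ι) (L : DualV K ι →ₗ[K] What K ι) : Prop :=
  IsCont L ∧ ∀ (i : ι) (f : PS K ι), ((L (y K i)).1 f).1 = P i f.1

/-- First class: `H_i + ħ D_i δ_{i ≤ N-1}` for `i ≥ 0`. -/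
def classOne (N : ℤ) (D : ℕ → K) (i : ℕ) (f : Raw K ℕ) : Raw K ℕ :=
  hamiltonian (boson K) N i i f + hpow K 2 (trunc D (N - 1) i • f)

/-- Second class: `H_i + ħ D_i δ_{i ≤ N+1}` for `i ≥ 1`, and `ħ∂_0 + (ħ²/2) C_0 ∂_0² + ħ D_0`
for `i = 0`. -/
def classTwo (N : ℤ) (C₀ : K) (D : ℕ → K) (i : ℕ) (f : Raw K ℕ) : Raw K ℕ :=
  if i = 0 then
    hpow K 2 (pd K 0 f) + hpow K 4 ((C₀ / 2) • pd K 0 (pd K 0 f)) + hpow K 2 (D 0 • f)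
  else hamiltonian (boson K) N i i f + hpow K 2 (trunc D (N + 1) i • f)

/-- Third class: `H_i + ħ D_i δ_{i ≤ N+1}` with `b_0 = 0`, for `i ≥ 1`. -/
def classThree (N : ℤ) (D : ℕ → K) (i : ℕ+) (f : Raw K ℕ+) : Raw K ℕ+ :=
  hamiltonian (bosonRed K) N i ((i : ℕ) : ℤ) f + hpow K 2 (trunc D (N + 1) i • f)

/-- The relation `[A, B] = ħ c C`. -/
def BracketEq (A B : What K ι) (c : ℤ) (C : What K ι) : Prop :=
  A * B - B * A = hbarW K ι * ((c : K) • C)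

end Boson

end

end Airy

open Airy

namespace Airy

-- The half-integral powers of ħ disappear after rescaling: `J_k = √ħ b_k` is `ħ∂_k` for `k ≥ 0` and
-- a multiple of a variable for `k < 0`. It lies in the Weyl algebra, and `ħ :b_k b_l:` becomes
-- `:J_k J_l:`. In a normally ordered product the mode of larger index acts first. A given series
-- involves only finitely many variables below a given degree, so `J_k f` tends to zero as `k → ∞`.
-- Hence the sums `ħL_m` converge pointwise, and the `H_i` tend to zero. Such a family extends
-- uniquely to a continuous map on `V^*`, because the `y_i` span a dense subspace.
--
-- The Virasoro relation is not computed by reordering double sums. An element of the completed Weyl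
-- algebra that commutes with every variable and kills `1` is zero (`eq_zero_of_commute`). Both
-- sides of `[ħL_m, ħL_n] = ħ(m-n) ħL_{m+n}` have the same commutators with the variables, by the
-- Jacobi identity and `[ħL_m, J_n] = -nħJ_{m+n}`. For distinct `m, n ≥ -1` both sides kill `1`, so
-- no central term occurs. Adding the linear terms gives (∗). The constants `D_i` are central, so
-- they survive exactly when no bracket with nonzero coefficient hits their index: `i + j ≥ 1` for
-- distinct `i, j ≥ 0`, and `i + j ≥ 3` for distinct `i, j ≥ 1`.
--
-- Each target index is reached by finitely many pairs, so the relations pass to infinite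
-- combinations by separate continuity (`isSubalgebraic_of_structure_constants`). Commutators in the
-- completed Weyl algebra are divisible by ħ (`exists_commutator`), so subalgebraicity implies the
-- condition on the left ideal. The linear part and the order are read off from degrees.

local instance ringEndPS {K ι : Type*} [Field K] : Ring (Module.End K (PS K ι)) :=
  Module.End.instRing

local instance ringEndRaw {K ι : Type*} [Field K] : Ring (Module.End K (Raw K ι)) :=
  Module.End.instRing

/-! ### Degree filtration and coefficients of series -/

section Basic

variable {K : Type*} [Field K] {ι : Type*}

theorem PS_ext {f g : PS K ι} (h : ∀ e, f.1 e = g.1 e) : f = g :=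
  Subtype.ext (funext h)

theorem deg_nonneg {f : PS K ι} {e : Mon ι} (h : f.1 e ≠ 0) : 0 ≤ deg e := by
  have := (f.2.1 e h).1
  simp only [deg]
  positivity

theorem mem_filt_iff {n : ℤ} {f : PS K ι} : f ∈ filt K ι n ↔ ∀ e, deg e < n → f.1 e = 0 := by
  refine ⟨fun h e he => ?_, fun h e he => ?_⟩
  · by_contra h'
    exact absurd (h e h') (not_le.2 he)
  · by_contra! h'
    exact he (h e h')

theorem eq_zero_of_mem_filt {f : PS K ι} (h : ∀ n, f ∈ filt K ι n) : f = 0 :=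
  PS_ext fun e => mem_filt_iff.1 (h (deg e + 1)) e (lt_add_one _)

theorem eq_of_sub_mem_filt {f g : PS K ι} (h : ∀ n, f - g ∈ filt K ι n) : f = g :=
  sub_eq_zero.1 (eq_zero_of_mem_filt h)

theorem What_filt {T : Module.End K (PS K ι)} (hT : T ∈ What K ι) {n : ℤ} {f : PS K ι}
    (hf : f ∈ filt K ι n) : T f ∈ filt K ι n := by
  obtain ⟨W, hW, h⟩ := hT {f} n
  simpa using (filt K ι n).add_mem (h f (by simp)) (weyl_filt hW n hf)

theorem finite_deg_lt (f : PS K ι) (n : ℤ) : {e | deg e < n ∧ f.1 e ≠ 0}.Finite := by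
  refine ((Finset.Ico 0 n).finite_toSet.biUnion fun d _ => f.2.2 d).subset ?_
  rintro e ⟨hd, he⟩
  simp only [Finset.coe_Ico, Set.mem_iUnion]
  exact ⟨deg e, ⟨deg_nonneg he, hd⟩, rfl, he⟩

theorem deg_add_single (p : ℤ) (α : ι →₀ ℕ) (i : ι) :
    deg (p, α + Finsupp.single i 1) = deg (p, α) + 1 := by
  simp only [deg, map_add, Finsupp.degree_single]
  push_cast
  ring

/-- Only finitely many variables occur in the terms of bounded degree. -/
theorem exists_opD_mem_filt (f : PS K ι) (n : ℤ) :
    ∃ J : Finset ι, ∀ i ∉ J, opD K i f ∈ filt K ι n := by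
  classical
  refine ⟨(finite_deg_lt f (n + 1)).toFinset.biUnion fun e => e.2.support, fun i hi => ?_⟩
  refine mem_filt_iff.2 fun e he => ?_
  change ((e.2 i : K) + 1) * f.1 (e.1, e.2 + Finsupp.single i 1) = 0
  by_contra h
  refine hi (Finset.mem_biUnion.2 ⟨(e.1, e.2 + Finsupp.single i 1), ?_, by simp⟩)
  simp only [Set.Finite.mem_toFinset, Set.mem_ofPred_eq]
  refine ⟨?_, right_ne_zero_of_mul h⟩
  rw [deg_add_single]
  simpa using he

theorem hbar_coeff (f : PS K ι) (e : Mon ι) : (hbar K ι f).1 e = f.1 (e.1 - 2, e.2) := rfl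

theorem opD_coeff (i : ι) (f : PS K ι) (e : Mon ι) :
    (opD K i f).1 e = ((e.2 i : K) + 1) * f.1 (e.1, e.2 + Finsupp.single i 1) := rfl

theorem opX_coeff (i : ι) (f : PS K ι) (e : Mon ι) :
    (opX K i f).1 e = if e.2 i = 0 then 0 else f.1 (e.1, e.2 - Finsupp.single i 1) := rfl

theorem hbar_mem_weyl : hbar K ι ∈ weyl K ι :=
  Algebra.subset_adjoin (Or.inl (Or.inl rfl))

theorem opX_mem_weyl (i : ι) : opX K i ∈ weyl K ι :=
  Algebra.subset_adjoin (Or.inl (Or.inr ⟨i, rfl⟩))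

theorem hbar_opD_mem_weyl (i : ι) : hbar K ι * opD K i ∈ weyl K ι :=
  Algebra.subset_adjoin (Or.inr ⟨i, rfl⟩)

theorem hbar_injective : Function.Injective (hbar K ι) := by
  intro f g h
  refine PS_ext fun e => ?_
  have := congrArg (fun u : PS K ι => u.1 (e.1 + 2, e.2)) h
  simpa [hbar_coeff] using this

theorem hbar_filt {n : ℤ} {f : PS K ι} : hbar K ι f ∈ filt K ι (n + 2) ↔ f ∈ filt K ι n := by
  constructor
  · intro h e he
    have := h (e.1 + 2, e.2) (by simpa [hbar_coeff] using he)
    simp only [deg] at this ⊢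
    lia
  · intro h e he
    have := h (e.1 - 2, e.2) he
    simp only [deg] at this ⊢
    lia

end Basic

/-! ### Canonical commutation relations -/

section RawCommutation

variable {K : Type*} [Field K] {ι : Type*}

theorem hpow_mul_hpow (m n : ℤ) : hpow K m * hpow K n = (hpow K (m + n) : Module.End K (Raw K ι)) := by
  refine LinearMap.ext fun f => funext fun e => ?_
  simp [hpow, sub_sub]

theorem hpow_zero : (hpow K 0 : Module.End K (Raw K ι)) = 1 := by
  refine LinearMap.ext fun f => funext fun e => ?_
  simp [hpow]

theorem pd_mul_pd (i j : ι) : pd K i * pd K j = pd K j * pd K i := by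
  rcases eq_or_ne i j with rfl | h
  · rfl
  refine LinearMap.ext fun f => funext fun e => ?_
  simp only [pd, Module.End.mul_apply, LinearMap.coe_mk, AddHom.coe_mk, Finsupp.coe_add,
    Pi.add_apply, Finsupp.single_eq_of_ne h, Finsupp.single_eq_of_ne h.symm]
  rw [add_right_comm]
  simp only [add_zero]
  ring

theorem mulX_mul_mulX (i j : ι) : mulX K i * mulX K j = mulX K j * mulX K i := by
  rcases eq_or_ne i j with rfl | h
  · rfl
  refine LinearMap.ext fun f => funext fun e => ?_
  simp only [mulX, Module.End.mul_apply, LinearMap.coe_mk, AddHom.coe_mk, Finsupp.coe_tsub,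
    Pi.sub_apply, Finsupp.single_eq_of_ne h, Finsupp.single_eq_of_ne h.symm, tsub_zero]
  rw [tsub_right_comm]
  split_ifs <;> rfl

theorem pd_mul_mulX [DecidableEq ι] (i j : ι) :
    pd K i * mulX K j - mulX K j * pd K i = if i = j then 1 else 0 := by
  refine LinearMap.ext fun f => funext fun e => ?_
  rcases eq_or_ne i j with rfl | h
  · simp only [pd, mulX, Module.End.mul_apply, LinearMap.coe_mk, AddHom.coe_mk, Finsupp.coe_add,
      LinearMap.sub_apply, Pi.add_apply, Pi.sub_apply, Finsupp.single_eq_same, if_true,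
      Module.End.one_apply, add_tsub_cancel_right, Finsupp.coe_tsub]
    by_cases h0 : e.2 i = 0
    · simp [h0]
    · have h3 : e.2 - Finsupp.single i 1 + Finsupp.single i 1 = e.2 :=
        tsub_add_cancel_of_le (by simpa [Finsupp.single_le_iff] using Nat.one_le_iff_ne_zero.2 h0)
      simp only [Nat.succ_ne_zero, if_false, h0, h3]
      rw [Nat.cast_sub (Nat.one_le_iff_ne_zero.2 h0)]
      push_cast
      ring
  · have h4 : ¬ e.2 j = 0 → e.2 - Finsupp.single j 1 + Finsupp.single i 1 =
        e.2 + Finsupp.single i 1 - Finsupp.single j 1 := by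
      intro h0
      rw [tsub_add_eq_add_tsub]
      simpa [Finsupp.single_le_iff] using Nat.one_le_iff_ne_zero.2 h0
    simp only [pd, mulX, Module.End.mul_apply, LinearMap.coe_mk, AddHom.coe_mk, Finsupp.coe_add,
      LinearMap.sub_apply, Pi.add_apply, Pi.sub_apply, Finsupp.single_eq_of_ne h,
      Finsupp.single_eq_of_ne h.symm, if_neg h, Finsupp.coe_tsub, add_zero, tsub_zero]
    by_cases h0 : e.2 j = 0
    · simp [h0]
    · simp [h0, h4 h0]

theorem opX_mul_opX (i j : ι) : opX K i * opX K j = opX K j * opX K i :=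
  LinearMap.ext fun f => Subtype.ext (LinearMap.congr_fun (mulX_mul_mulX i j) f.1)

theorem opD_mul_opD (i j : ι) : opD K i * opD K j = opD K j * opD K i :=
  LinearMap.ext fun f => Subtype.ext (LinearMap.congr_fun (pd_mul_pd i j) f.1)

theorem hbar_mul_opX (i : ι) : hbar K ι * opX K i = opX K i * hbar K ι := rfl

theorem opD_mul_opX [DecidableEq ι] (i j : ι) :
    opD K i * opX K j - opX K j * opD K i = if i = j then 1 else 0 := by
  refine LinearMap.ext fun f => Subtype.ext ((LinearMap.congr_fun (pd_mul_mulX i j) f.1).trans ?_)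
  split_ifs <;> rfl

end RawCommutation

/-! ### Divisibility of commutators by ħ -/

section Commutators

variable {K : Type*} [Field K] {ι : Type*}

theorem hbar_mul_weyl {W : Module.End K (PS K ι)} (hW : W ∈ weyl K ι) :
    hbar K ι * W = W * hbar K ι := by
  induction hW using Algebra.adjoin_induction with
  | mem W hW =>
    rcases hW with (hW | ⟨i, rfl⟩) | ⟨i, rfl⟩
    · rw [Set.mem_singleton_iff.1 hW]
    · rfl
    · rfl
  | algebraMap r => exact (Algebra.commutes r _).symm
  | add S T _ _ hS hT => rw [mul_add, add_mul, hS, hT]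
  | mul S T _ _ hS hT => rw [← mul_assoc, hS, mul_assoc, hT, mul_assoc]

theorem hbar_mul_What {T : Module.End K (PS K ι)} (hT : T ∈ What K ι) :
    hbar K ι * T = T * hbar K ι := by
  classical
  refine LinearMap.ext fun f => eq_of_sub_mem_filt fun n => ?_
  obtain ⟨W, hW, h⟩ := hT {f, hbar K ι f} n
  have h1 := weyl_filt hbar_mem_weyl n (h f (by simp))
  have h2 := h (hbar K ι f) (by simp)
  have h3 : hbar K ι (W f) = W (hbar K ι f) := LinearMap.congr_fun (hbar_mul_weyl hW) f
  have := (filt K ι n).sub_mem h1 h2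
  rw [map_sub, h3] at this
  simpa using this

theorem hbarW_comm (T : What K ι) : hbarW K ι * T = T * hbarW K ι :=
  Subtype.ext (hbar_mul_What T.2)

/-- Since ħ is central and the commutator is a derivation in each argument, it suffices to look at
generators, where only `[ħ∂_i, x^i] = ħ` is nonzero. -/
theorem exists_weyl_commutator {S T : Module.End K (PS K ι)} (hS : S ∈ weyl K ι)
    (hT : T ∈ weyl K ι) : ∃ U ∈ weyl K ι, S * T - T * S = hbar K ι * U := by
  classical
  -- Leibniz rule in the second argument; with antisymmetry it is applied twice, once for each
  -- argument.
  have key : ∀ A ∈ weyl K ι, ∀ G : Set (Module.End K (PS K ι)),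
      (∀ B ∈ G, ∃ U ∈ weyl K ι, A * B - B * A = hbar K ι * U) →
      G ⊆ weyl K ι → ∀ B ∈ Algebra.adjoin K G, ∃ U ∈ weyl K ι, A * B - B * A = hbar K ι * U := by
    intro A _ G hG hGW B hB
    have hle : Algebra.adjoin K G ≤ weyl K ι := Algebra.adjoin_le hGW
    induction hB using Algebra.adjoin_induction with
    | mem B hB => exact hG B hB
    | algebraMap r => exact ⟨0, zero_mem _, by rw [Algebra.commutes r A]; simp⟩
    | add P Q _ _ hP hQ =>
      obtain ⟨U, hU, h⟩ := hP
      obtain ⟨U', hU', h'⟩ := hQ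
      exact ⟨U + U', add_mem hU hU', by rw [mul_add (hbar K ι), ← h, ← h']; noncomm_ring⟩
    | mul P Q hPm hQm hP hQ =>
      obtain ⟨U, hU, h⟩ := hP
      obtain ⟨U', hU', h'⟩ := hQ
      refine ⟨U * Q + P * U', add_mem (mul_mem hU (hle hQm)) (mul_mem (hle hPm) hU'), ?_⟩
      rw [mul_add, ← mul_assoc (hbar K ι) U, ← h, ← mul_assoc (hbar K ι) P,
        hbar_mul_weyl (hle hPm), mul_assoc P (hbar K ι), ← h']
      noncomm_ring
  have symm : ∀ A B : Module.End K (PS K ι), (∃ U ∈ weyl K ι, A * B - B * A = hbar K ι * U) →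
      ∃ U ∈ weyl K ι, B * A - A * B = hbar K ι * U := by
    rintro A B ⟨U, hU, h⟩
    exact ⟨-U, neg_mem hU, by rw [mul_neg, ← h, neg_sub]⟩
  refine key S hS _ (fun B hB => ?_) Algebra.subset_adjoin T hT
  refine symm B S (key B (Algebra.subset_adjoin hB) _ (fun A hA => ?_) Algebra.subset_adjoin S hS)
  have comm : ∀ {A B : Module.End K (PS K ι)}, A * B = B * A →
      ∃ U ∈ weyl K ι, A * B - B * A = hbar K ι * U :=
    fun h => ⟨0, zero_mem _, by rw [h, sub_self, mul_zero]⟩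
  have hDX : ∀ i j : ι, ∃ U ∈ weyl K ι,
      hbar K ι * opD K i * opX K j - opX K j * (hbar K ι * opD K i) = hbar K ι * U := by
    intro i j
    refine ⟨if i = j then 1 else 0, by split_ifs; exacts [one_mem _, zero_mem _], ?_⟩
    rw [← opD_mul_opX, ← mul_assoc, ← hbar_mul_opX, mul_sub, mul_assoc, mul_assoc]
  rcases hA with (hA | ⟨i, rfl⟩) | ⟨i, rfl⟩
  · rw [Set.mem_singleton_iff.1 hA]
    exact comm (hbar_mul_weyl (Algebra.subset_adjoin hB)).symm
  all_goals rcases hB with (hB | ⟨j, rfl⟩) | ⟨j, rfl⟩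
  · rw [Set.mem_singleton_iff.1 hB]
    exact comm rfl
  · exact comm (opX_mul_opX _ _)
  · exact hDX _ _
  · rw [Set.mem_singleton_iff.1 hB]
    exact comm rfl
  · exact symm _ _ (hDX _ _)
  · refine comm ?_
    change hbar K ι * (hbar K ι * (opD K j * opD K i)) = hbar K ι * (hbar K ι * (opD K i * opD K j))
    rw [opD_mul_opD]

/-- The exponents of `√ħ` are even and non-negative, so without terms of exponent zero all of them
are at least 2. -/
theorem exists_hbar_eq {g : PS K ι} (hg : ∀ e, e.1 = 0 → g.1 e = 0) : ∃ h, hbar K ι h = g := by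
  refine ⟨⟨hpow K (-2) g.1, fun e he => ?_, fun d => ?_⟩, ?_⟩
  · have h0 : g.1 (e.1 - -2, e.2) ≠ 0 := he
    obtain ⟨h1, r, h2⟩ := g.2.1 _ h0
    have h3 : e.1 - -2 ≠ 0 := fun h => h0 (hg _ h)
    simp only at h1 h2
    exact ⟨by lia, r - 1, by lia⟩
  · refine ((g.2.2 (d + 2)).image fun e => (e.1 - 2, e.2)).subset ?_
    rintro e ⟨hd, he⟩
    refine ⟨(e.1 + 2, e.2), ⟨?_, ?_⟩, by simp⟩
    · simp only [deg] at hd ⊢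
      lia
    · have h0 : g.1 (e.1 - -2, e.2) ≠ 0 := he
      simpa using h0
  · refine PS_ext fun e => ?_
    simp [hbar_coeff, hpow]

/-- Approximating both operators makes `[S, T] f` a limit of multiples of ħ. The multiples of ħ form
a closed subspace and ħ is injective, so `[S, T]` can be divided by ħ. -/
theorem exists_commutator (S T : What K ι) : ∃ U : What K ι, S * T - T * S = hbarW K ι * U := by
  classical
  have approx : ∀ (s : Finset (PS K ι)) (n : ℤ), ∃ W ∈ weyl K ι, ∀ f ∈ s,
      (S.1 * T.1 - T.1 * S.1) f - hbar K ι (W f) ∈ filt K ι n := by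
    intro s n
    -- `B` is chosen before `A`, because `A` also has to be accurate on the images `B f`.
    obtain ⟨B, hB, hB'⟩ := T.2 (s ∪ s.image S.1) n
    obtain ⟨A, hA, hA'⟩ := S.2 (s ∪ s.image B) n
    obtain ⟨U, hU, h⟩ := exists_weyl_commutator hA hB
    refine ⟨U, hU, fun f hf => ?_⟩
    have h1 := What_filt S.2 (hB' f (Finset.mem_union_left _ hf))
    have h2 := hA' (B f) (Finset.mem_union_right _ (Finset.mem_image_of_mem _ hf))
    have h3 := hB' (S.1 f) (Finset.mem_union_right _ (Finset.mem_image_of_mem _ hf))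
    have h4 := weyl_filt hB n (hA' f (Finset.mem_union_left _ hf))
    have h5 := (filt K ι n).sub_mem ((filt K ι n).add_mem h1 h2) ((filt K ι n).add_mem h3 h4)
    have h6 : hbar K ι (U f) = A (B f) - B (A f) := (LinearMap.congr_fun h f).symm
    rw [h6]
    convert h5 using 1
    simp only [LinearMap.sub_apply, Module.End.mul_apply, map_sub]
    abel
  have hrange : ∀ f, (S.1 * T.1 - T.1 * S.1) f ∈ LinearMap.range (hbar K ι) := by
    intro f
    refine exists_hbar_eq fun e he => ?_
    obtain ⟨W, _, h⟩ := approx {f} (deg e + 1)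
    have h1 := mem_filt_iff.1 (h f (by simp)) e (lt_add_one _)
    have h2 : (hbar K ι (W f)).1 e = 0 := by
      by_contra h0
      have := ((W f).2.1 (e.1 - 2, e.2) h0).1
      simp only at this
      lia
    simpa [h2] using h1
  let E := LinearEquiv.ofInjective (hbar K ι) hbar_injective
  let U : Module.End K (PS K ι) := E.symm.toLinearMap ∘ₗ LinearMap.codRestrict _ _ hrange
  have hU : ∀ f, hbar K ι (U f) = (S.1 * T.1 - T.1 * S.1) f := fun f =>
    congrArg Subtype.val (E.apply_symm_apply ⟨_, hrange f⟩)
  refine ⟨⟨U, fun s n => ?_⟩, Subtype.ext (LinearMap.ext fun f => (hU f).symm)⟩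
  -- Dividing by ħ costs two degrees of accuracy.
  obtain ⟨W, hW, h⟩ := approx s (n + 2)
  refine ⟨W, hW, fun f hf => ?_⟩
  have := h f hf
  rwa [← hU, ← map_sub, hbar_filt] at this

end Commutators

/-! ### Pointwise convergent sums of operators -/

section Sums

variable {K : Type*} [Field K] {ι κ : Type*}

/-- `∑_k T_k = S` for the topology of pointwise convergence. -/
def HasPtSum (T : κ → Module.End K (PS K ι)) (S : Module.End K (PS K ι)) : Prop :=
  ∀ (f : PS K ι) (n : ℤ), ∃ s₀ : Finset κ, ∀ s, s₀ ⊆ s → S f - ∑ k ∈ s, T k f ∈ filt K ι n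

/-- The family tends to zero pointwise. -/
def PtSummable (T : κ → Module.End K (PS K ι)) : Prop :=
  ∀ (f : PS K ι) (n : ℤ), ∃ s₀ : Finset κ, ∀ k ∉ s₀, T k f ∈ filt K ι n

theorem HasPtSum.unique {T : κ → Module.End K (PS K ι)} {S S' : Module.End K (PS K ι)}
    (h : HasPtSum T S) (h' : HasPtSum T S') : S = S' := by
  classical
  refine LinearMap.ext fun f => eq_of_sub_mem_filt fun n => ?_
  obtain ⟨s, hs⟩ := h f n
  obtain ⟨s', hs'⟩ := h' f n
  simpa using (filt K ι n).sub_mem (hs (s ∪ s') Finset.subset_union_left)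
    (hs' (s ∪ s') Finset.subset_union_right)

theorem HasPtSum.add {T T' : κ → Module.End K (PS K ι)} {S S' : Module.End K (PS K ι)}
    (h : HasPtSum T S) (h' : HasPtSum T' S') : HasPtSum (fun k => T k + T' k) (S + S') := by
  classical
  intro f n
  obtain ⟨s, hs⟩ := h f n
  obtain ⟨s', hs'⟩ := h' f n
  refine ⟨s ∪ s', fun t ht => ?_⟩
  have := (filt K ι n).add_mem (hs t (Finset.union_subset_left ht))
    (hs' t (Finset.union_subset_right ht))
  simpa [Finset.sum_add_distrib, add_sub_add_comm] using this

/-- Membership of `A` in `What` is what keeps the error in the filtration; multiplication on the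
right needs no such condition. -/
theorem HasPtSum.mul_left {T : κ → Module.End K (PS K ι)} {S : Module.End K (PS K ι)}
    (h : HasPtSum T S) {A : Module.End K (PS K ι)} (hA : A ∈ What K ι) :
    HasPtSum (fun k => A * T k) (A * S) := by
  intro f n
  obtain ⟨s, hs⟩ := h f n
  refine ⟨s, fun t ht => ?_⟩
  simpa using What_filt hA (hs t ht)

theorem HasPtSum.mul_right {T : κ → Module.End K (PS K ι)} {S : Module.End K (PS K ι)}
    (h : HasPtSum T S) (A : Module.End K (PS K ι)) : HasPtSum (fun k => T k * A) (S * A) :=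
  fun f n => h (A f) n

theorem HasPtSum.commutator {T : κ → Module.End K (PS K ι)} {S : Module.End K (PS K ι)}
    (h : HasPtSum T S) {A : Module.End K (PS K ι)} (hA : A ∈ What K ι) :
    HasPtSum (fun k => T k * A - A * T k) (S * A - A * S) := by
  have := (h.mul_right A).add (h.mul_left (neg_mem hA))
  simpa only [neg_mul, ← sub_eq_add_neg] using this

theorem HasPtSum.smul {T : κ → Module.End K (PS K ι)} {S : Module.End K (PS K ι)}
    (h : HasPtSum T S) (c : K) : HasPtSum (fun k => c • T k) (c • S) := by
  intro f n
  obtain ⟨s, hs⟩ := h f n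
  refine ⟨s, fun t ht => ?_⟩
  simpa [← Finset.smul_sum, ← smul_sub] using (filt K ι n).smul_mem c (hs t ht)

theorem hasPtSum_finset {T : κ → Module.End K (PS K ι)} (s : Finset κ) (h : ∀ k ∉ s, T k = 0) :
    HasPtSum T (∑ k ∈ s, T k) := by
  intro f n
  refine ⟨s, fun t ht => ?_⟩
  rw [LinearMap.sum_apply, Finset.sum_subset ht fun k _ hk => by simp [h k hk], sub_self]
  exact zero_mem _

theorem HasPtSum.mem_filt {T : κ → Module.End K (PS K ι)} {S : Module.End K (PS K ι)}
    (h : HasPtSum T S) {f : PS K ι} {n : ℤ} (hT : ∀ k, T k f ∈ filt K ι n) : S f ∈ filt K ι n := by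
  obtain ⟨s, hs⟩ := h f n
  simpa using (filt K ι n).add_mem (hs s subset_rfl) (sum_mem fun k (_ : k ∈ s) => hT k)

theorem HasPtSum.apply_eq_zero {T : κ → Module.End K (PS K ι)} {S : Module.End K (PS K ι)}
    (h : HasPtSum T S) {f : PS K ι} (hT : ∀ k, T k f = 0) : S f = 0 :=
  eq_zero_of_mem_filt fun _ => h.mem_filt fun k => by rw [hT k]; exact zero_mem _

theorem HasPtSum.exists_coeff {T : κ → Module.End K (PS K ι)} {S : Module.End K (PS K ι)}
    (h : HasPtSum T S) (f : PS K ι) (e : Mon ι) :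
    ∃ s : Finset κ, (S f).1 e = ∑ k ∈ s, (T k f).1 e := by
  obtain ⟨s, hs⟩ := h f (deg e + 1)
  refine ⟨s, ?_⟩
  have := mem_filt_iff.1 (hs s subset_rfl) e (lt_add_one _)
  simpa [sub_eq_zero] using this

/-- Below degree `n` only the finitely many `k ∈ s f n` contribute, so the sum is finite
coefficientwise and has finite support in each degree. -/
theorem PtSummable.exists_hasPtSum {T : κ → Module.End K (PS K ι)} (hT : PtSummable T)
    (hW : ∀ k, T k ∈ What K ι) : ∃ S ∈ What K ι, HasPtSum T S ∧
      ∀ f e, (S f).1 e = ∑ᶠ k, (T k f).1 e := by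
  classical
  choose s hs using hT
  have hcoeff : ∀ f n e, deg e < n → ∑ᶠ k, (T k f).1 e = ∑ k ∈ s f n, (T k f).1 e := by
    intro f n e he
    refine finsum_eq_sum_of_support_subset _ fun k hk => ?_
    by_contra h
    exact hk (mem_filt_iff.1 (hs f n k h) e he)
  have hfin : ∀ f e, (Function.support fun k => (T k f).1 e).Finite := by
    intro f e
    refine (s f (deg e + 1)).finite_toSet.subset fun k hk => ?_
    by_contra h
    exact hk (mem_filt_iff.1 (hs f (deg e + 1) k h) e (lt_add_one _))
  let S : Module.End K (PS K ι) :=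
    { toFun := fun f => ⟨fun e => ∑ᶠ k, (T k f).1 e, by
        refine ⟨fun e he => ?_, fun d => ?_⟩
        · obtain ⟨k, hk⟩ : ∃ k, (T k f).1 e ≠ 0 := by
            by_contra! h
            exact he (by simp [h])
          exact (T k f).2.1 e hk
        · refine ((s f (d + 1)).finite_toSet.biUnion fun k _ => (T k f).2.2 d).subset ?_
          rintro e ⟨hd, he⟩
          replace he : ∑ᶠ k, (T k f).1 e ≠ 0 := he
          rw [hcoeff f (d + 1) e (by lia)] at he
          obtain ⟨k, hk, hk'⟩ := Finset.exists_ne_zero_of_sum_ne_zero he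
          exact Set.mem_biUnion hk ⟨hd, hk'⟩⟩
      map_add' := fun f g => PS_ext fun e => by
        simpa using finsum_add_distrib (hfin f e) (hfin g e)
      map_smul' := fun c f => PS_ext fun e => by
        simpa using (mul_finsum' (fun k => (T k f).1 e) c (hfin f e)).symm }
  have hS : HasPtSum T S := by
    intro f n
    refine ⟨s f n, fun t ht => mem_filt_iff.2 fun e he => ?_⟩
    have h1 : (S f).1 e = ∑ k ∈ t, (T k f).1 e := by
      refine (hcoeff f n e he).trans (Finset.sum_subset ht fun k _ hk => ?_)
      exact mem_filt_iff.1 (hs f n k hk) e he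
    simp [h1]
  refine ⟨S, fun F n => ?_, hS, fun f e => rfl⟩
  -- One finite partial sum serves all series in `F`; it is then itself approximated by a
  -- differential operator.
  have hsum : ∑ k ∈ F.biUnion (fun f => s f n), T k ∈ What K ι := sum_mem fun k _ => hW k
  obtain ⟨W, hWm, h⟩ := hsum F n
  refine ⟨W, hWm, fun f hf => ?_⟩
  have h1 : S f - ∑ k ∈ F.biUnion (fun f => s f n), T k f ∈ filt K ι n := by
    refine mem_filt_iff.2 fun e he => ?_
    have h1 : (S f).1 e = ∑ k ∈ F.biUnion (fun f => s f n), (T k f).1 e := by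
      refine (hcoeff f n e he).trans (Finset.sum_subset
        (Finset.subset_biUnion_of_mem (fun f => s f n) hf) fun k _ hk => ?_)
      exact mem_filt_iff.1 (hs f n k hk) e he
    simp [h1]
  simpa using (filt K ι n).add_mem h1 (h f hf)

end Sums

/-! ### Degrees of operators -/

section Grading

variable {K : Type*} [Field K] {ι κ : Type*}

/-- `T` has components only in the degrees that belong to `D`. -/
def DegIn (D : Set ℤ) (T : Module.End K (PS K ι)) : Prop :=
  ∀ (f : PS K ι) (e : Mon ι), (∀ e', deg e - deg e' ∈ D → f.1 e' = 0) → (T f).1 e = 0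

theorem DegIn.mono {D D' : Set ℤ} (h : D ⊆ D') {T : Module.End K (PS K ι)} (hT : DegIn D T) :
    DegIn D' T :=
  fun f e hf => hT f e fun e' he' => hf e' (h he')

theorem DegIn.add {D : Set ℤ} {S T : Module.End K (PS K ι)} (hS : DegIn D S) (hT : DegIn D T) :
    DegIn D (S + T) := by
  intro f e hf
  simp [hS f e hf, hT f e hf]

theorem DegIn.smul {D : Set ℤ} {T : Module.End K (PS K ι)} (hT : DegIn D T) (c : K) :
    DegIn D (c • T) := by
  intro f e hf
  simp [hT f e hf]

theorem DegIn.zero {D : Set ℤ} : DegIn D (0 : Module.End K (PS K ι)) := fun _ _ _ => rfl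

theorem DegIn.mul {a b : ℤ} {S T : Module.End K (PS K ι)} (hS : DegIn {a} S) (hT : DegIn {b} T) :
    DegIn {a + b} (S * T) := by
  intro f e hf
  refine hS _ _ fun e' he' => hT _ _ fun e'' he'' => hf e'' ?_
  simp only [Set.mem_singleton_iff] at he' he'' ⊢
  lia

theorem HasPtSum.degIn {D : Set ℤ} {T : κ → Module.End K (PS K ι)} {S : Module.End K (PS K ι)}
    (h : HasPtSum T S) (hT : ∀ k, DegIn D (T k)) : DegIn D S := by
  intro f e hf
  obtain ⟨s, hs⟩ := h.exists_coeff f e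
  rw [hs]
  exact Finset.sum_eq_zero fun k _ => hT k f e hf

theorem degIn_hbar : DegIn {2} (hbar K ι) := by
  intro f e hf
  refine hf _ ?_
  simp [deg]

theorem degIn_opX (i : ι) : DegIn {1} (opX K i) := by
  intro f e hf
  rw [opX_coeff]
  split_ifs with h
  · rfl
  · refine hf _ ?_
    have h3 : e.2 - Finsupp.single i 1 + Finsupp.single i 1 = e.2 :=
      tsub_add_cancel_of_le (by simpa [Finsupp.single_le_iff] using Nat.one_le_iff_ne_zero.2 h)
    have h4 := deg_add_single e.1 (e.2 - Finsupp.single i 1) i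
    rw [h3] at h4
    rw [Set.mem_singleton_iff]
    change deg (e.1, e.2) - _ = 1
    lia

theorem degIn_hbar_opD (i : ι) : DegIn {1} (hbar K ι * opD K i) := by
  have h : DegIn {-1} (opD K i) := by
    intro f e hf
    rw [opD_coeff, hf _, mul_zero]
    rw [deg_add_single, Set.mem_singleton_iff]
    change deg (e.1, e.2) - _ = _
    ring
  exact degIn_hbar.mul h

theorem degComp_add (d : ℤ) (S T : Module.End K (PS K ι)) :
    degComp d (S + T) = degComp d S + degComp d T := rfl

theorem lowPart_eq_self {n : ℕ} {T : Module.End K (PS K ι)} (hT : DegIn (Set.Icc 0 (n : ℤ)) T) :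
    lowPart n T = T := by
  refine LinearMap.ext fun f => PS_ext fun e => ?_
  have h1 : (lowPart n T f).1 e =
      (T (∑ d ∈ Finset.range (n + 1), degPart (deg e - d) f)).1 e := by
    simp [lowPart, degComp]
  rw [h1, ← sub_eq_zero]
  -- The truncation of `f` and `f` itself agree in every degree that can influence the coefficient
  -- at `e`.
  have h2 := hT (∑ d ∈ Finset.range (n + 1), degPart (deg e - d) f - f) e ?_
  · simpa using h2
  · intro e' he'
    obtain ⟨d, hd⟩ := Int.eq_ofNat_of_zero_le he'.1
    have hd' : d ∈ Finset.range (n + 1) := by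
      have := he'.2
      rw [Finset.mem_range]
      lia
    have h3 : ∀ c : ℕ, (degPart (deg e - c) f).1 e' = if c = d then f.1 e' else 0 := by
      intro c
      have : deg e' = deg e - c ↔ c = d := by lia
      simp [degPart, this]
    simp [h3, Finset.mem_range.1 hd']

theorem lowPart_eq_zero {n : ℕ} {T : Module.End K (PS K ι)} {D : Set ℤ} (hT : DegIn D T)
    (hD : ∀ d ∈ D, (n : ℤ) < d) : lowPart n T = 0 := by
  refine LinearMap.ext fun f => PS_ext fun e => ?_
  have h1 : (lowPart n T f).1 e =
      ∑ d ∈ Finset.range (n + 1), (T (degPart (deg e - d) f)).1 e := by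
    simp [lowPart, degComp]
  rw [h1]
  refine Finset.sum_eq_zero fun d hd => hT _ _ fun e' he' => ?_
  have h2 := hD _ he'
  rw [Finset.mem_range] at hd
  exact if_neg (by lia)

theorem lowPart_add (n : ℕ) (S T : Module.End K (PS K ι)) :
    lowPart n (S + T) = lowPart n S + lowPart n T := by
  simp [lowPart, degComp_add, Finset.sum_add_distrib]

end Grading

/-! ### Operators determined by their commutators with the variables -/

section Density

variable {K : Type*} [Field K] {ι : Type*}

/-- The monomial `ħ^p x^α`. -/
noncomputable def mon (K : Type*) [Field K] {ι : Type*} (p : ℕ) (α : ι →₀ ℕ) : PS K ι := by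
  classical
  refine ⟨Pi.single ((2 * p : ℤ), α) 1, fun e he => ?_, fun d => ?_⟩
  · rw [Pi.single_apply] at he
    simp only [ne_eq, ite_eq_right_iff, one_ne_zero, imp_false, not_not] at he
    rw [he]
    exact ⟨by positivity, by simp⟩
  · refine (Set.finite_singleton ((2 * p : ℤ), α)).subset fun e he => ?_
    by_contra h
    exact he.2 (Pi.single_eq_of_ne h _)

open Classical in
theorem mon_coeff (p : ℕ) (α : ι →₀ ℕ) (e : Mon ι) :
    (mon K p α).1 e = if e = ((2 * p : ℤ), α) then 1 else 0 := by
  simp [mon, Pi.single_apply]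

theorem hbar_mon (p : ℕ) (α : ι →₀ ℕ) : hbar K ι (mon K p α) = mon K (p + 1) α := by
  classical
  refine PS_ext fun e => ?_
  rw [hbar_coeff, mon_coeff, mon_coeff]
  congr 1
  refine propext ?_
  rw [Prod.ext_iff, Prod.ext_iff]
  refine and_congr_left fun _ => ?_
  push_cast
  lia

theorem opX_mon (i : ι) (p : ℕ) (α : ι →₀ ℕ) :
    opX K i (mon K p α) = mon K p (α + Finsupp.single i 1) := by
  classical
  refine PS_ext fun e => ?_
  rw [opX_coeff, mon_coeff, mon_coeff]
  split_ifs with h1 h2 h3 h4 h5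
  · simp [h2] at h1
  · rfl
  · rfl
  · refine absurd ?_ h4
    have h6 : e.2 - Finsupp.single i 1 + Finsupp.single i 1 = e.2 :=
      tsub_add_cancel_of_le (by simpa [Finsupp.single_le_iff] using Nat.one_le_iff_ne_zero.2 h1)
    simp only [Prod.mk.injEq] at h3
    rw [← h3.2, h6, ← h3.1]
  · simp [h5] at h3
  · rfl

theorem opD_mon_zero (i : ι) : opD K i (mon K 0 0) = 0 := by
  classical
  refine PS_ext fun e => ?_
  rw [opD_coeff, mon_coeff, if_neg, mul_zero]
  · rfl
  · intro h
    have := DFunLike.congr_fun (congrArg Prod.snd h) i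
    simp at this

/-- An element of the completed Weyl algebra that commutes with all variables and annihilates the
constants is zero. -/
theorem eq_zero_of_commute {X : Module.End K (PS K ι)} (hX : X ∈ What K ι)
    (hc : ∀ i, X * opX K i = opX K i * X) (h1 : X (mon K 0 0) = 0) : X = 0 := by
  classical
  -- Induction on the degree: a variable is split off and moved past `X`.
  have h2 : ∀ (n : ℕ) (α : ι →₀ ℕ), α.degree = n → X (mon K 0 α) = 0 := by
    intro n
    induction n with
    | zero =>
      intro α hα
      rw [Finsupp.degree_eq_zero_iff] at hα
      rw [hα, h1]
    | succ n ih =>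
      intro α hα
      obtain ⟨i, hi⟩ : ∃ i, α i ≠ 0 := by
        by_contra! h
        have : α = 0 := Finsupp.ext h
        simp [this] at hα
      have h6 : α - Finsupp.single i 1 + Finsupp.single i 1 = α :=
        tsub_add_cancel_of_le (by simpa [Finsupp.single_le_iff] using Nat.one_le_iff_ne_zero.2 hi)
      have h7 := congrArg Finsupp.degree h6
      simp only [map_add, Finsupp.degree_single] at h7
      rw [← h6, ← opX_mon, ← Module.End.mul_apply, hc, Module.End.mul_apply, ih _ (by lia), map_zero]
  have h3 : ∀ (p : ℕ) (α : ι →₀ ℕ), X (mon K p α) = 0 := by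
    intro p α
    induction p with
    | zero => exact h2 _ α rfl
    | succ p ih =>
      rw [← hbar_mon, ← Module.End.mul_apply, ← hbar_mul_What hX, Module.End.mul_apply, ih, map_zero]
  refine LinearMap.ext fun f => eq_zero_of_mem_filt fun n => ?_
  have hfin := finite_deg_lt f n
  -- Modulo terms of degree at least `n`, `f` is a finite combination of monomials, and `X`
  -- preserves the filtration.
  have h4 : f - ∑ e ∈ hfin.toFinset, f.1 e • mon K (e.1 / 2).toNat e.2 ∈ filt K ι n := by
    refine mem_filt_iff.2 fun e he => ?_
    have h5 : ∀ e' ∈ hfin.toFinset, (f.1 e' • mon K (e'.1 / 2).toNat e'.2).1 e =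
        if e = e' then f.1 e' else 0 := by
      intro e' he'
      simp only [Set.Finite.mem_toFinset, Set.mem_ofPred_eq] at he'
      obtain ⟨h6, r, h7⟩ := f.2.1 e' he'.2
      have h8 : (2 * ((e'.1 / 2).toNat : ℤ), e'.2) = e' := Prod.ext (by simp only; lia) rfl
      rw [SetLike.val_smul, Pi.smul_apply, mon_coeff, h8]
      simp
    have h6 : (∑ e ∈ hfin.toFinset, f.1 e • mon K (e.1 / 2).toNat e.2).1 e = f.1 e := by
      rw [AddSubmonoidClass.coe_finsetSum, Finset.sum_apply, Finset.sum_congr rfl h5]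
      simp
      intro h
      by_contra h'
      exact h' (h he).symm
    rw [AddSubgroupClass.coe_sub, Pi.sub_apply, h6, sub_self]
  simpa [h3] using What_filt hX h4

end Density

/-! ### Continuous maps on `V^*` -/

section Dual

variable {K : Type*} [Field K] {ι : Type*}

theorem dual_eq_zero {φ : DualV K ι} {v : ι →₀ K}
    (h : ∀ i ∈ v.support, φ (Finsupp.single i 1) = 0) : φ v = 0 := by
  rw [← Finsupp.sum_single v, Finsupp.sum, map_sum]
  refine Finset.sum_eq_zero fun i hi => ?_
  have h1 : Finsupp.single i (v i) = v i • Finsupp.single i (1 : K) := by simp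
  rw [h1, map_smul, h i hi, smul_zero]

theorem dual_ext {φ ψ : DualV K ι} (h : ∀ i, φ (Finsupp.single i 1) = ψ (Finsupp.single i 1)) :
    φ = ψ := by
  refine Finsupp.lhom_ext' fun i => LinearMap.ext_ring ?_
  exact h i

theorem y_single [DecidableEq ι] (i j : ι) :
    y K i (Finsupp.single j 1) = if j = i then 1 else 0 := by
  simp [y, Finsupp.single_apply]

/-- Finitely many vectors of `V` involve finitely many basis vectors, so these suffice as test
vectors. -/
theorem isCont_iff {L : DualV K ι →ₗ[K] What K ι} : IsCont L ↔ ∀ (f : PS K ι) (n : ℤ),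
    ∃ s : Finset ι, ∀ φ : DualV K ι, (∀ i ∈ s, φ (Finsupp.single i 1) = 0) →
      (L φ).1 f ∈ filt K ι n := by
  classical
  constructor
  · intro h f n
    obtain ⟨s, hs⟩ := h f n
    exact ⟨s.biUnion Finsupp.support, fun φ hφ => hs φ fun v hv => dual_eq_zero fun i hi =>
      hφ i (Finset.mem_biUnion.2 ⟨v, hv, hi⟩)⟩
  · intro h f n
    obtain ⟨s, hs⟩ := h f n
    exact ⟨s.image fun i => Finsupp.single i 1, fun φ hφ => hs φ fun i hi =>
      hφ _ (Finset.mem_image_of_mem _ hi)⟩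

/-- The `y_i` span a dense subspace: subtracting a finite combination of them makes `φ` vanish on
any given finite set of basis vectors. -/
theorem IsCont.apply_eq_zero {L : DualV K ι →ₗ[K] What K ι} (hL : IsCont L)
    (h : ∀ i, L (y K i) = 0) (φ : DualV K ι) : L φ = 0 := by
  classical
  refine Subtype.ext (LinearMap.ext fun f => eq_zero_of_mem_filt fun n => ?_)
  obtain ⟨s, hs⟩ := isCont_iff.1 hL f n
  have h1 := hs (φ - ∑ i ∈ s, φ (Finsupp.single i 1) • y K i) fun i hi => by
    simp [LinearMap.sum_apply, y_single, hi]
  have h2 : L (∑ i ∈ s, φ (Finsupp.single i 1) • y K i) = 0 := by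
    rw [map_sum]
    exact Finset.sum_eq_zero fun i _ => by rw [map_smul, h, smul_zero]
  rwa [map_sub, h2, sub_zero] at h1

theorem IsCont.ext {L L' : DualV K ι →ₗ[K] What K ι} (hL : IsCont L) (hL' : IsCont L')
    (h : ∀ i, L (y K i) = L' (y K i)) : L = L' := by
  have hc : IsCont (L - L') := by
    classical
    refine isCont_iff.2 fun f n => ?_
    obtain ⟨s, hs⟩ := isCont_iff.1 hL f n
    obtain ⟨s', hs'⟩ := isCont_iff.1 hL' f n
    exact ⟨s ∪ s', fun φ hφ => (filt K ι n).sub_mem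
      (hs φ fun i hi => hφ i (Finset.mem_union_left _ hi))
      (hs' φ fun i hi => hφ i (Finset.mem_union_right _ hi))⟩
  refine LinearMap.ext fun φ => sub_eq_zero.1 ?_
  exact hc.apply_eq_zero (fun i => sub_eq_zero.2 (h i)) φ

/-- A family of operators that tends to zero extends to a continuous map on `V^*`. -/
theorem exists_isCont {P : ι → What K ι} (hP : PtSummable fun i => (P i).1) :
    ∃ L : DualV K ι →ₗ[K] What K ι, IsCont L ∧ (∀ i, L (y K i) = P i) ∧
      ∀ φ, HasPtSum (fun i => φ (Finsupp.single i 1) • (P i).1) (L φ).1 := by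
  classical
  have hsum : ∀ φ : DualV K ι, PtSummable fun i => φ (Finsupp.single i 1) • (P i).1 := by
    intro φ f n
    obtain ⟨s, hs⟩ := hP f n
    exact ⟨s, fun i hi => (filt K ι n).smul_mem _ (hs i hi)⟩
  choose S hS hS' _ using fun φ => (hsum φ).exists_hasPtSum fun i => (What K ι).smul_mem (P i).2 _
  refine ⟨⟨⟨fun φ => ⟨S φ, hS φ⟩, fun φ ψ => Subtype.ext ?_⟩, fun c φ => Subtype.ext ?_⟩,
    isCont_iff.2 fun f n => ?_, fun i => Subtype.ext ?_, hS'⟩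
  · refine (hS' (φ + ψ)).unique ?_
    simp only [LinearMap.add_apply, add_smul]
    exact (hS' φ).add (hS' ψ)
  · refine (hS' (c • φ)).unique ?_
    simp only [LinearMap.smul_apply, smul_assoc]
    exact (hS' φ).smul c
  · obtain ⟨s, hs⟩ := hP f n
    refine ⟨s, fun φ hφ => (hS' φ).mem_filt fun i => ?_⟩
    by_cases hi : i ∈ s
    · rw [hφ i hi, zero_smul]
      exact zero_mem _
    · exact (filt K ι n).smul_mem _ (hs i hi)
  · refine (hS' (y K i)).unique ?_
    have := hasPtSum_finset (T := fun j => y K i (Finsupp.single j 1) • (P j).1) {i} fun j hj => by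
      rw [y_single, if_neg (by simpa using hj), zero_smul]
    simpa [y_single] using this

theorem IsCont.hasPtSum {P : ι → What K ι} (hP : PtSummable fun i => (P i).1)
    {L : DualV K ι →ₗ[K] What K ι} (hL : IsCont L) (hLP : ∀ i, L (y K i) = P i) (φ : DualV K ι) :
    HasPtSum (fun i => φ (Finsupp.single i 1) • (P i).1) (L φ).1 := by
  obtain ⟨L', hL', h1, h2⟩ := exists_isCont hP
  rw [hL.ext hL' fun i => (hLP i).trans (h1 i).symm]
  exact h2 φ

theorem isGivenBy_iff {P : ι → What K ι} {Q : ι → Raw K ι → Raw K ι}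
    (hQ : ∀ i (f : PS K ι), ((P i).1 f).1 = Q i f.1) {L : DualV K ι →ₗ[K] What K ι} :
    IsGivenBy Q L ↔ IsCont L ∧ ∀ i, L (y K i) = P i := by
  refine and_congr_right fun _ => ⟨fun h i => ?_, fun h i f => ?_⟩
  · exact Subtype.ext (LinearMap.ext fun f => Subtype.ext ((h i f).trans (hQ i f).symm))
  · rw [h i, hQ]

theorem existsUnique_isGivenBy {P : ι → What K ι} {Q : ι → Raw K ι → Raw K ι}
    (hQ : ∀ i (f : PS K ι), ((P i).1 f).1 = Q i f.1) (hP : PtSummable fun i => (P i).1) :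
    ∃! L : DualV K ι →ₗ[K] What K ι, IsGivenBy Q L := by
  obtain ⟨L, h1, h2, _⟩ := exists_isCont hP
  refine ⟨L, (isGivenBy_iff hQ).2 ⟨h1, h2⟩, fun L' hL' => ?_⟩
  obtain ⟨h3, h4⟩ := (isGivenBy_iff hQ).1 hL'
  exact h3.ext h1 fun i => (h4 i).trans (h2 i).symm

end Dual

/-! ### Airy structures from structure constants -/

section Structures

variable {K : Type*} [Field K] {ι : Type*}

/-- Since `[ra, b] = r[a, b] + [r, b]a` and `[r, b]` is divisible by ħ, both terms stay in ħ times
the left ideal. The argument runs over the first entry, then over the second. -/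
theorem IsSubalgebraic.involutive {L : DualV K ι →ₗ[K] What K ι} (hL : IsSubalgebraic L) :
    ∀ a ∈ Ideal.span (Set.range L), ∀ b ∈ Ideal.span (Set.range L),
      ∃ c ∈ Ideal.span (Set.range L), a * b - b * a = hbarW K ι * c := by
  have hzero : ∀ a : What K ι, a * 0 - 0 * a = hbarW K ι * 0 := fun a => by simp
  have hzero' : ∀ a : What K ι, 0 * a - a * 0 = hbarW K ι * 0 := fun a => by simp
  have base : ∀ a ∈ Ideal.span (Set.range L), ∀ ψ,
      ∃ c ∈ Ideal.span (Set.range L), a * L ψ - L ψ * a = hbarW K ι * c := by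
    intro a ha ψ
    induction ha using Submodule.span_induction with
    | mem a ha =>
      obtain ⟨φ, rfl⟩ := ha
      obtain ⟨χ, h⟩ := hL φ ψ
      exact ⟨L χ, Ideal.subset_span ⟨χ, rfl⟩, h⟩
    | zero => exact ⟨0, zero_mem _, hzero' _⟩
    | add a a' _ _ h h' =>
      obtain ⟨c, hc, h⟩ := h
      obtain ⟨c', hc', h'⟩ := h'
      exact ⟨c + c', add_mem hc hc', by rw [mul_add (hbarW K ι), ← h, ← h']; noncomm_ring⟩
    | smul r a ha h =>
      obtain ⟨c, hc, h⟩ := h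
      obtain ⟨U, hU⟩ := exists_commutator r (L ψ)
      refine ⟨r * c + U * a, add_mem (Ideal.mul_mem_left _ _ hc) (Ideal.mul_mem_left _ _ ha), ?_⟩
      rw [mul_add, ← mul_assoc, ← mul_assoc, hbarW_comm r, mul_assoc r, ← h, ← hU, smul_eq_mul]
      noncomm_ring
  intro a ha b hb
  induction hb using Submodule.span_induction with
  | mem b hb =>
    obtain ⟨ψ, rfl⟩ := hb
    exact base a ha ψ
  | zero => exact ⟨0, zero_mem _, hzero _⟩
  | add b b' _ _ h h' =>
    obtain ⟨c, hc, h⟩ := h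
    obtain ⟨c', hc', h'⟩ := h'
    exact ⟨c + c', add_mem hc hc', by rw [mul_add (hbarW K ι), ← h, ← h']; noncomm_ring⟩
  | smul r b hb h =>
    obtain ⟨c, hc, h⟩ := h
    obtain ⟨U, hU⟩ := exists_commutator a r
    refine ⟨r * c + U * b, add_mem (Ideal.mul_mem_left _ _ hc) (Ideal.mul_mem_left _ _ hb), ?_⟩
    rw [mul_add, ← mul_assoc, ← mul_assoc, hbarW_comm r, mul_assoc r, ← h, ← hU, smul_eq_mul]
    noncomm_ring

/-- Structure constants that are finite in number for each target index give a subalgebra. -/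
theorem isSubalgebraic_of_structure_constants {P : ι → What K ι} {c : ι → ι → K} {t : ι → ι → ι}
    (hbr : ∀ i j, P i * P j - P j * P i = hbarW K ι * (c i j • P (t i j)))
    (hfin : ∀ k, {p : ι × ι | t p.1 p.2 = k ∧ c p.1 p.2 ≠ 0}.Finite)
    {L : DualV K ι →ₗ[K] What K ι} (hL : IsCont L) (hLP : ∀ i, L (y K i) = P i) :
    IsSubalgebraic L := by
  classical
  -- The coefficient of `y_k` in the bracket of `φ` and `ψ`; `hfin` makes the sum over pairs with
  -- target `k` finite.
  let g : DualV K ι → DualV K ι → ι → K := fun φ ψ k => ∑ p ∈ (hfin k).toFinset,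
    c p.1 p.2 * (φ (Finsupp.single p.1 1) * ψ (Finsupp.single p.2 1))
  let χ : DualV K ι → DualV K ι → DualV K ι := fun φ ψ => Finsupp.linearCombination K (g φ ψ)
  have hχ : ∀ φ ψ k, χ φ ψ (Finsupp.single k 1) = g φ ψ k := fun φ ψ k => by
    simp [χ, Finsupp.linearCombination_single]
  have hadd1 : ∀ φ φ' ψ, χ (φ + φ') ψ = χ φ ψ + χ φ' ψ := fun φ φ' ψ => dual_ext fun k => by
    simp only [hχ, LinearMap.add_apply, g, add_mul, mul_add, Finset.sum_add_distrib]
  have hadd2 : ∀ φ ψ ψ', χ φ (ψ + ψ') = χ φ ψ + χ φ ψ' := fun φ ψ ψ' => dual_ext fun k => by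
    simp only [hχ, LinearMap.add_apply, g, mul_add, Finset.sum_add_distrib]
  have hsmul1 : ∀ (a : K) φ ψ, χ (a • φ) ψ = a • χ φ ψ := fun a φ ψ => dual_ext fun k => by
    simp only [hχ, LinearMap.smul_apply, g, smul_eq_mul, Finset.mul_sum]
    exact Finset.sum_congr rfl fun p _ => by ring
  have hsmul2 : ∀ (a : K) φ ψ, χ φ (a • ψ) = a • χ φ ψ := fun a φ ψ => dual_ext fun k => by
    simp only [hχ, LinearMap.smul_apply, g, smul_eq_mul, Finset.mul_sum]
    exact Finset.sum_congr rfl fun p _ => by ring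
  have hy : ∀ i j, χ (y K i) (y K j) = c i j • y K (t i j) := fun i j => dual_ext fun k => by
    have h1 : ∀ p ∈ (hfin k).toFinset, c p.1 p.2 * (y K i (Finsupp.single p.1 1) *
        y K j (Finsupp.single p.2 1)) = if p = (i, j) then c i j else 0 := by
      rintro ⟨p, q⟩ _
      by_cases hp : p = i
      · by_cases hq : q = j
        · simp [y_single, hp, hq]
        · simp [y_single, hq]
      · simp [y_single, hp]
    rw [hχ, LinearMap.smul_apply, y_single]
    simp only [g]
    rw [Finset.sum_congr rfl h1, Finset.sum_ite_eq']
    by_cases hk : k = t i j <;> by_cases hc : c i j = 0 <;> simp [hk, hc]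
    intro h
    exact absurd h.symm hk
  -- The defect of the bracket relation. It is bilinear, continuous in each argument and zero on
  -- pairs `(y_i, y_j)`, hence zero by density, one argument at a time.
  let B : DualV K ι → DualV K ι → What K ι := fun φ ψ =>
    L φ * L ψ - L ψ * L φ - hbarW K ι * L (χ φ ψ)
  have hBadd1 : ∀ φ φ' ψ, B (φ + φ') ψ = B φ ψ + B φ' ψ := fun φ φ' ψ => by
    simp only [B, hadd1, map_add]
    noncomm_ring
  have hBadd2 : ∀ φ ψ ψ', B φ (ψ + ψ') = B φ ψ + B φ ψ' := fun φ ψ ψ' => by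
    simp only [B, hadd2, map_add]
    noncomm_ring
  have hBsmul1 : ∀ (a : K) φ ψ, B (a • φ) ψ = a • B φ ψ := fun a φ ψ => by
    simp only [B, hsmul1, map_smul]
    refine Subtype.ext (LinearMap.ext fun f => ?_)
    change a • _ - (L ψ).1 (a • _) - (hbarW K ι).1 (a • _) = a • (_ - _ - _)
    rw [map_smul, map_smul, smul_sub, smul_sub]
    rfl
  have hBsmul2 : ∀ (a : K) φ ψ, B φ (a • ψ) = a • B φ ψ := fun a φ ψ => by
    simp only [B, hsmul2, map_smul]
    refine Subtype.ext (LinearMap.ext fun f => ?_)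
    change (L φ).1 (a • _) - a • _ - (hbarW K ι).1 (a • _) = a • (_ - _ - _)
    rw [map_smul, map_smul, smul_sub, smul_sub]
    rfl
  have hbr' : ∀ i j, B (y K i) (y K j) = 0 := fun i j => by
    simp only [B, hLP, hy, map_smul, hbr, sub_self]
  have hcont : ∀ (f : PS K ι) (n : ℤ) (φ : DualV K ι), ∃ s : Finset ι, ∀ ψ : DualV K ι,
      (∀ i ∈ s, ψ (Finsupp.single i 1) = 0) →
      (B φ ψ).1 f ∈ filt K ι n ∧ (B ψ φ).1 f ∈ filt K ι n := by
    intro f n φ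
    obtain ⟨s1, h1⟩ := isCont_iff.1 hL f n
    obtain ⟨s2, h2⟩ := isCont_iff.1 hL ((L φ).1 f) n
    -- `s2` controls `L ψ (L φ f)` and `s1` controls `L ψ f`. The remaining indices make the
    -- coefficients of `χ φ ψ` and `χ ψ φ` vanish on `s1`.
    refine ⟨s2 ∪ s1 ∪ (s1.biUnion fun k => (hfin k).toFinset.image Prod.fst ∪
      (hfin k).toFinset.image Prod.snd), fun ψ hψ => ?_⟩
    have h3 : (L ψ).1 ((L φ).1 f) ∈ filt K ι n := h2 ψ fun i hi => hψ i (by simp [hi])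
    have h4 : (L φ).1 ((L ψ).1 f) ∈ filt K ι n :=
      What_filt (L φ).2 (h1 ψ fun i hi => hψ i (by simp [hi]))
    have h5 : ∀ k ∈ s1, ∀ p ∈ (hfin k).toFinset,
        ψ (Finsupp.single p.1 1) = 0 ∧ ψ (Finsupp.single p.2 1) = 0 := by
      intro k hk p hp
      refine ⟨hψ _ (Finset.mem_union_right _ (Finset.mem_biUnion.2 ⟨k, hk, ?_⟩)),
        hψ _ (Finset.mem_union_right _ (Finset.mem_biUnion.2 ⟨k, hk, ?_⟩))⟩
      · exact Finset.mem_union_left _ (Finset.mem_image_of_mem _ hp)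
      · exact Finset.mem_union_right _ (Finset.mem_image_of_mem _ hp)
    have h6 : (hbarW K ι).1 ((L (χ φ ψ)).1 f) ∈ filt K ι n := by
      refine What_filt (hbarW K ι).2 (h1 _ fun k hk => ?_)
      rw [hχ]
      exact Finset.sum_eq_zero fun p hp => by rw [(h5 k hk p hp).2, mul_zero, mul_zero]
    have h7 : (hbarW K ι).1 ((L (χ ψ φ)).1 f) ∈ filt K ι n := by
      refine What_filt (hbarW K ι).2 (h1 _ fun k hk => ?_)
      rw [hχ]
      exact Finset.sum_eq_zero fun p hp => by rw [(h5 k hk p hp).1, zero_mul, mul_zero]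
    exact ⟨sub_mem (sub_mem h4 h3) h6, sub_mem (sub_mem h3 h4) h7⟩
  let B1 : ∀ φ : DualV K ι, DualV K ι →ₗ[K] What K ι := fun φ =>
    ⟨⟨fun ψ => B φ ψ, hBadd2 φ⟩, fun a ψ => hBsmul2 a φ ψ⟩
  let B2 : ∀ ψ : DualV K ι, DualV K ι →ₗ[K] What K ι := fun ψ =>
    ⟨⟨fun φ => B φ ψ, fun φ φ' => hBadd1 φ φ' ψ⟩, fun a φ => hBsmul1 a φ ψ⟩
  have hB1 : ∀ φ, IsCont (B1 φ) := fun φ => isCont_iff.2 fun f n => by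
    obtain ⟨s, hs⟩ := hcont f n φ
    exact ⟨s, fun ψ hψ => (hs ψ hψ).1⟩
  have hB2 : ∀ ψ, IsCont (B2 ψ) := fun ψ => isCont_iff.2 fun f n => by
    obtain ⟨s, hs⟩ := hcont f n ψ
    exact ⟨s, fun φ hφ => (hs φ hφ).2⟩
  have h8 : ∀ φ j, B φ (y K j) = 0 := fun φ j =>
    (hB2 (y K j)).apply_eq_zero (fun i => hbr' i j) φ
  exact fun φ ψ => ⟨χ φ ψ, sub_eq_zero.1 ((hB1 φ).apply_eq_zero (h8 φ) ψ)⟩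

theorem isQuadratic_of_degIn {P : ι → What K ι} (hP : PtSummable fun i => (P i).1)
    (hdeg : ∀ i, DegIn {1, 2} (P i).1) (hlin : ∀ i, lowPart 1 (P i).1 = hbar K ι * opD K i)
    (hne : ∃ i, (P i).1 ≠ hbar K ι * opD K i)
    {L : DualV K ι →ₗ[K] What K ι} (hL : IsCont L) (hLP : ∀ i, L (y K i) = P i) :
    IsQuadratic L := by
  refine ⟨⟨two_pos, fun φ => ?_⟩, ?_⟩
  · refine (lowPart_eq_self ?_).symm
    refine ((hL.hasPtSum hP hLP φ).degIn fun i => (hdeg i).smul _).mono ?_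
    intro d hd
    simp only [Set.mem_insert_iff, Set.mem_singleton_iff] at hd
    simp only [Set.mem_Icc]
    lia
  · rintro n ⟨hn, h⟩
    by_contra h2
    -- If order one sufficed, every `P i` would equal its linear part, against `hne`.
    obtain rfl : n = 1 := by lia
    obtain ⟨i, hi⟩ := hne
    refine hi ?_
    have := h (y K i)
    rwa [hLP, hlin] at this

theorem isQuantumAiry_of_family {P : ι → What K ι} (hP : PtSummable fun i => (P i).1)
    (hdeg : ∀ i, DegIn {1, 2} (P i).1) (hlin : ∀ i, lowPart 1 (P i).1 = hbar K ι * opD K i)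
    (hne : ∃ i, (P i).1 ≠ hbar K ι * opD K i) {c : ι → ι → K} {t : ι → ι → ι}
    (hbr : ∀ i j, P i * P j - P j * P i = hbarW K ι * (c i j • P (t i j)))
    (hfin : ∀ k, {p : ι × ι | t p.1 p.2 = k ∧ c p.1 p.2 ≠ 0}.Finite)
    {L : DualV K ι →ₗ[K] What K ι} (hL : IsCont L) (hLP : ∀ i, L (y K i) = P i) :
    IsQuantumAiry L ∧ IsQuadratic L ∧ IsSubalgebraic L := by
  have hsub := isSubalgebraic_of_structure_constants hbr hfin hL hLP
  exact ⟨⟨hL, hsub.involutive, fun i => by rw [hLP, hlin]⟩,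
    isQuadratic_of_degIn hP hdeg hlin hne hL hLP, hsub⟩

end Structures

/-! ### Virasoro operators built from abstract modes -/

section Modes

variable {K : Type*} [Field K] {ι : Type*}

/-- The operators `J_k = √ħ b_k` act on `K[[V, ħ]]`, where `x^i` has index `z i`. -/
structure IsModes (b : ℤ → Module.End K (Raw K ι)) (z : ι → ℕ)
    (J : ℤ → Module.End K (PS K ι)) : Prop where
  inj : Function.Injective z
  val : ∀ k f, (J k f).1 = hpow K 1 (b k f.1)
  comm : ∀ k, hpow K 1 * b k = b k * hpow K 1
  heis : IsHeisenberg b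
  mem : ∀ k, J k ∈ weyl K ι
  pos : ∀ i, J (z i) = hbar K ι * opD K i
  tail : ∀ f n, ∃ B : ℤ, ∀ k, B ≤ k → J k f ∈ filt K ι n
  vac : ∀ k, 0 ≤ k → J k (mon K 0 0) = 0
  commX : ∀ k a, J k * opX K a - opX K a * J k = if k = z a then hbar K ι else 0
  deg : ∀ k, DegIn {1} (J k)
  neg : J (-1) (mon K 0 0) ≠ 0

/-- The normally ordered product `:J_k J_l:`. -/
def nordPS (J : ℤ → Module.End K (PS K ι)) (k l : ℤ) : Module.End K (PS K ι) :=
  if k ≤ l then J k * J l else J l * J k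

variable {b : ℤ → Module.End K (Raw K ι)} {z : ι → ℕ} {J : ℤ → Module.End K (PS K ι)}

namespace IsModes

theorem memW (h : IsModes b z J) (k : ℤ) : J k ∈ What K ι := weyl_le_What (h.mem k)

/-- The two factors `√ħ` combine to the integral power ħ. -/
theorem mul_val (h : IsModes b z J) (k l : ℤ) (f : PS K ι) :
    ((J k * J l) f).1 = hpow K 2 ((b k * b l) f.1) := by
  rw [Module.End.mul_apply, h.val, h.val, ← Module.End.mul_apply (b k), ← h.comm,
    Module.End.mul_apply, ← Module.End.mul_apply (hpow K 1), hpow_mul_hpow]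
  rfl

theorem nordPS_val (h : IsModes b z J) (k l : ℤ) (f : PS K ι) :
    (nordPS J k l f).1 = hpow K 2 (nord b k l f.1) := by
  simp only [nordPS, nord]
  split_ifs <;> exact h.mul_val _ _ _

theorem commJ (h : IsModes b z J) (m n : ℤ) :
    J m * J n - J n * J m = if m = -n then (m : K) • hbar K ι else 0 := by
  refine LinearMap.ext fun f => Subtype.ext ?_
  have h1 : ((J m * J n - J n * J m) f).1 = hpow K 2 ((b m * b n - b n * b m) f.1) := by
    rw [LinearMap.sub_apply, AddSubgroupClass.coe_sub, h.mul_val, h.mul_val, ← map_sub]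
    rfl
  rw [h1, h.heis]
  split_ifs <;> rfl

theorem nordPS_mem (h : IsModes b z J) (k l : ℤ) : nordPS J k l ∈ weyl K ι := by
  simp only [nordPS]
  split_ifs
  exacts [mul_mem (h.mem k) (h.mem l), mul_mem (h.mem l) (h.mem k)]

/-- Normal ordering lets the mode of larger index act first, so one large index is enough. -/
theorem nordPS_filt (h : IsModes b z J) {f : PS K ι} {n B : ℤ}
    (hB : ∀ k, B ≤ k → J k f ∈ filt K ι n) {k l : ℤ} (hkl : B ≤ k ∨ B ≤ l) :
    nordPS J k l f ∈ filt K ι n := by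
  simp only [nordPS]
  split_ifs with h1
  · exact weyl_filt (h.mem k) n (hB l (by lia))
  · exact weyl_filt (h.mem l) n (hB k (by lia))

theorem ptSummable_nordPS (h : IsModes b z J) (m : ℤ) :
    PtSummable fun k => (1 / 2 : K) • nordPS J k (m - k) := by
  intro f n
  obtain ⟨B, hB⟩ := h.tail f n
  -- Outside this interval, `k ≥ B` or `m - k ≥ B`.
  refine ⟨Finset.Ioo (m - B) B, fun k hk => (filt K ι n).smul_mem _ (h.nordPS_filt hB ?_)⟩
  rw [Finset.mem_Ioo] at hk
  lia

theorem exists_vir (h : IsModes b z J) (m : ℤ) : ∃ V : What K ι,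
    HasPtSum (fun k => (1 / 2 : K) • nordPS J k (m - k)) V.1 ∧
      ∀ f, (V.1 f).1 = hpow K 2 (virasoro b m f.1) := by
  obtain ⟨V, hV, h1, h2⟩ := (h.ptSummable_nordPS m).exists_hasPtSum fun k =>
    (What K ι).smul_mem (weyl_le_What (h.nordPS_mem _ _)) _
  refine ⟨⟨V, hV⟩, h1, fun f => funext fun e => (h2 f e).trans ?_⟩
  change _ = (1 / 2 : K) • ∑ᶠ k : ℤ, nord b k (m - k) f.1 (e.1 - 2, e.2)
  rw [smul_finsum]
  refine finsum_congr fun k => ?_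
  rw [LinearMap.smul_apply, SetLike.val_smul, Pi.smul_apply, h.nordPS_val]
  rfl

/-- `ħ L_m` as an element of the completed Weyl algebra. -/
noncomputable def vir (h : IsModes b z J) (m : ℤ) : What K ι := (h.exists_vir m).choose

theorem vir_hasPtSum (h : IsModes b z J) (m : ℤ) :
    HasPtSum (fun k => (1 / 2 : K) • nordPS J k (m - k)) (h.vir m).1 :=
  (h.exists_vir m).choose_spec.1

theorem vir_val (h : IsModes b z J) (m : ℤ) (f : PS K ι) :
    ((h.vir m).1 f).1 = hpow K 2 (virasoro b m f.1) :=
  (h.exists_vir m).choose_spec.2 f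

/-- One of `k` and `m - k` is at least `m / 2`; this makes `ħL_m` tend to zero as `m → ∞`. -/
theorem vir_filt (h : IsModes b z J) {f : PS K ι} {n B : ℤ}
    (hB : ∀ k, B ≤ k → J k f ∈ filt K ι n) {m : ℤ} (hm : 2 * B ≤ m) :
    (h.vir m).1 f ∈ filt K ι n :=
  (h.vir_hasPtSum m).mem_filt fun k => (filt K ι n).smul_mem _ (h.nordPS_filt hB (by lia))

theorem vir_degIn (h : IsModes b z J) (m : ℤ) : DegIn {2} (h.vir m).1 := by
  refine (h.vir_hasPtSum m).degIn fun k => DegIn.smul ?_ _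
  simp only [nordPS]
  split_ifs
  exacts [(h.deg _).mul (h.deg _), (h.deg _).mul (h.deg _)]

/-- If `k + l ≥ -1`, the larger of the two indices is non-negative, and that mode acts first. This
excludes a central term. -/
theorem vir_vac (h : IsModes b z J) {m : ℤ} (hm : -1 ≤ m) : (h.vir m).1 (mon K 0 0) = 0 := by
  refine (h.vir_hasPtSum m).apply_eq_zero fun k => ?_
  rw [LinearMap.smul_apply, nordPS]
  split_ifs with h1
  · rw [Module.End.mul_apply, h.vac _ (by lia), map_zero, smul_zero]
  · rw [Module.End.mul_apply, h.vac _ (by lia), map_zero, smul_zero]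

/-- The operator `ħ∂_p + ħ L_{p+N-1} + ħ c`. -/
noncomputable def ham (h : IsModes b z J) (N p : ℤ) (c : K) : What K ι :=
  ⟨J p, h.memW p⟩ + h.vir (p + N - 1) + c • hbarW K ι

theorem ham_coe (h : IsModes b z J) (N p : ℤ) (c : K) :
    (h.ham N p c).1 = J p + (h.vir (p + N - 1)).1 + c • hbar K ι := rfl

theorem ham_degIn (h : IsModes b z J) (N p : ℤ) (c : K) : DegIn {1, 2} (h.ham N p c).1 := by
  rw [ham_coe]
  refine (((h.deg p).mono ?_).add ((h.vir_degIn _).mono ?_)).add ((degIn_hbar.smul c).mono ?_) <;>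
    simp

theorem lowPart_ham (h : IsModes b z J) (N p : ℤ) (c : K) :
    lowPart 1 (h.ham N p c).1 = J p := by
  rw [ham_coe, lowPart_add, lowPart_add, lowPart_eq_self ((h.deg p).mono ?_),
    lowPart_eq_zero (h.vir_degIn _) ?_, lowPart_eq_zero (degIn_hbar.smul c) ?_, add_zero, add_zero]
  all_goals simp

theorem finite_index_lt (h : IsModes b z J) (B : ℕ) : {i | z i < B}.Finite :=
  (Set.finite_Iio B).preimage h.inj.injOn

theorem ptSummable_ham (h : IsModes b z J) {P : ι → What K ι} {N : ℤ} {R : ℕ}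
    (hP : ∀ i, R ≤ z i → P i = h.ham N (z i) 0) : PtSummable fun i => (P i).1 := by
  intro f n
  obtain ⟨B, hB⟩ := h.tail f n
  -- Beyond `R` there are no constants, `B` handles the linear term, and `2B - N + 1` gives `2B ≤ z
  -- i + N - 1` for the quadratic one.
  refine ⟨(h.finite_index_lt (max R (max B (2 * B - N + 1)).toNat)).toFinset, fun i hi => ?_⟩
  simp only [Set.Finite.mem_toFinset, Set.mem_ofPred_eq, not_lt, sup_le_iff, Int.toNat_le] at hi
  change (P i).1 f ∈ filt K ι n
  rw [hP i hi.1, ham_coe, zero_smul, add_zero]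
  exact add_mem (hB _ hi.2.1) (h.vir_filt hB (by lia))

theorem ham_val (h : IsModes b z J) (N : ℤ) (i : ι) (c : K) (f : PS K ι) :
    ((h.ham N (z i) c).1 f).1 = hamiltonian b N i (z i) f.1 + hpow K 2 (c • f.1) := by
  rw [ham_coe, h.pos, hamiltonian, ← h.vir_val]
  rfl

variable [CharZero K]

/-- The commutator of `ħ L_m` with an operator that fails to commute with one mode only. -/
theorem vir_commutator (h : IsModes b z J) (m : ℤ) {A Z : Module.End K (PS K ι)}
    (hA : A ∈ What K ι) {k₀ : ℤ} (hAJ : ∀ k, J k * A - A * J k = if k = k₀ then Z else 0)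
    (hZ : ∀ k, J k * Z = Z * J k) : (h.vir m).1 * A - A * (h.vir m).1 = Z * J (m - k₀) := by
  classical
  have h1 := (h.vir_hasPtSum m).commutator hA
  -- `T₁` and `T₂` collect the contributions of the two factors. Each has one nonzero term, at `k₀`
  -- and at `m - k₀`, equal to half of `Z * J (m - k₀)`.
  let T₁ : ℤ → Module.End K (PS K ι) := fun k =>
    (1 / 2 : K) • ((if k = k₀ then Z else 0) * J (m - k))
  let T₂ : ℤ → Module.End K (PS K ι) := fun k =>
    (1 / 2 : K) • ((if m - k = k₀ then Z else 0) * J k)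
  have h2 := hasPtSum_finset (T := T₁) {k₀} fun k hk => by
    simp [T₁, show k ≠ k₀ by simpa using hk]
  have h3 := hasPtSum_finset (T := T₂) {m - k₀} fun k hk => by
    have : m - k ≠ k₀ := by
      rw [Finset.mem_singleton] at hk
      lia
    simp [T₂, this]
  have hcomm : ∀ k l, J k * (if l = k₀ then Z else 0) = (if l = k₀ then Z else 0) * J k := by
    intro k l
    split_ifs
    · exact hZ k
    · rw [mul_zero, zero_mul]
  -- Since `Z` commutes with the modes, the result is symmetric in `k` and `l`, so the normal
  -- ordering plays no role.
  have key : ∀ k l, J k * J l * A - A * (J k * J l) =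
      (if k = k₀ then Z else 0) * J l + (if l = k₀ then Z else 0) * J k := by
    intro k l
    rw [← hcomm k l, ← hAJ, ← hAJ]
    noncomm_ring
  have h4 : (fun k => (1 / 2 : K) • nordPS J k (m - k) * A - A * (1 / 2 : K) • nordPS J k (m - k)) =
      fun k => T₁ k + T₂ k := by
    funext k
    simp only [T₁, T₂, nordPS]
    rw [smul_mul_assoc, mul_smul_comm, ← smul_sub, ← smul_add]
    congr 1
    by_cases h5 : k ≤ m - k
    · rw [if_pos h5, key]
    · rw [if_neg h5, key, add_comm]
  rw [h4] at h1
  rw [h1.unique (h2.add h3)]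
  simp only [Finset.sum_singleton, T₁, T₂, if_true, sub_sub_cancel]
  rw [← add_smul]
  norm_num

theorem vir_commX (h : IsModes b z J) (m : ℤ) (a : ι) :
    (h.vir m).1 * opX K a - opX K a * (h.vir m).1 = hbar K ι * J (m - z a) :=
  h.vir_commutator m (weyl_le_What (opX_mem_weyl a)) (fun k => h.commX k a) fun k =>
    (hbar_mul_weyl (h.mem k)).symm

theorem vir_commJ (h : IsModes b z J) (m n : ℤ) :
    (h.vir m).1 * J n - J n * (h.vir m).1 = (-n : K) • (hbar K ι * J (m + n)) := by
  have := h.vir_commutator m (h.memW n) (k₀ := -n) (Z := ((-n : ℤ) : K) • hbar K ι)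
    (fun k => ?_) fun k => ?_
  · rw [this, smul_mul_assoc, sub_neg_eq_add]
    push_cast
    rfl
  · rw [h.commJ]
    split_ifs with hk
    · rw [hk]
    · rfl
  · rw [mul_smul_comm, smul_mul_assoc, hbar_mul_weyl (h.mem k)]

/-- The Virasoro relations `[L_m, L_n] = (m - n) L_{m+n}` for `m, n ≥ -1`. -/
theorem vir_comm (h : IsModes b z J) {m n : ℤ} (hm : -1 ≤ m) (hn : -1 ≤ n) :
    (h.vir m).1 * (h.vir n).1 - (h.vir n).1 * (h.vir m).1 =
      ((m : K) - n) • (hbar K ι * (h.vir (m + n)).1) := by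
  -- The case `m = n = -1` must be separated, since `L_{-2}` need not kill `1`; distinct `m, n ≥ -1`
  -- have `m + n ≥ -1`.
  rcases eq_or_ne m n with rfl | hmn
  · rw [sub_self, sub_self, zero_smul]
  have hh : hbar K ι ∈ What K ι := weyl_le_What hbar_mem_weyl
  rw [← sub_eq_zero]
  refine eq_zero_of_commute ?_ (fun a => ?_) ?_
  · refine (((h.vir m * h.vir n - h.vir n * h.vir m) -
      ((m : K) - n) • (hbarW K ι * h.vir (m + n)) : What K ι)).2
  · have hp := h.vir_commX m a
    have hq := h.vir_commX n a
    have hr := h.vir_commX (m + n) a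
    have hvq := h.vir_commJ m (n - z a)
    have hwp := h.vir_commJ n (m - z a)
    have hv := hbar_mul_What (h.vir m).2
    have hw := hbar_mul_What (h.vir n).2
    have hx : hbar K ι * opX K a = opX K a * hbar K ι := hbar_mul_opX a
    rw [show m + (n - z a) = m + n - z a by ring] at hvq
    rw [show n + (m - z a) = m + n - z a by ring] at hwp
    generalize (h.vir m).1 = v at *
    generalize (h.vir n).1 = w at *
    generalize (h.vir (m + n)).1 = u at *
    generalize opX K a = x at *
    generalize J (m + n - z a) = r at *
    generalize J (m - z a) = p at *
    generalize J (n - z a) = q at *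
    generalize hbar K ι = t at *
    -- Jacobi identity. Both inner commutators are ħ times modes, so the outer ones reduce to
    -- multiples of ħ²`J (m + n - z a)`.
    have e1 : (v * w - w * v) * x - x * (v * w - w * v) =
        (v * (w * x - x * w) - (w * x - x * w) * v) -
          (w * (v * x - x * v) - (v * x - x * v) * w) := by noncomm_ring
    have e2 : v * (t * q) - t * q * v = t * (v * q - q * v) := by
      rw [← mul_assoc, ← hv]
      noncomm_ring
    have e3 : w * (t * p) - t * p * w = t * (w * p - p * w) := by
      rw [← mul_assoc, ← hw]
      noncomm_ring
    have e4 : t * u * x - x * (t * u) = t * (u * x - x * u) := by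
      rw [← mul_assoc, ← hx]
      noncomm_ring
    rw [hp, hq, e2, e3, hvq, hwp] at e1
    rw [hr] at e4
    rw [← sub_eq_zero, sub_mul, mul_sub, smul_mul_assoc, mul_smul_comm, sub_sub_sub_comm, e1,
      ← smul_sub, e4, mul_smul_comm, mul_smul_comm, ← sub_smul, ← sub_smul]
    convert zero_smul K _ using 2
    push_cast
    ring
  · rw [LinearMap.sub_apply, LinearMap.sub_apply, Module.End.mul_apply, Module.End.mul_apply,
      LinearMap.smul_apply, Module.End.mul_apply, h.vir_vac hm, h.vir_vac hn,
      h.vir_vac (by lia : -1 ≤ m + n)]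
    simp

/-- `[H_p, H_q] = ħ (p - q) H_{p+q+N-1}`. -/
theorem ham_comm (h : IsModes b z J) {N p q r : ℤ} (hp : 0 ≤ p) (hq : 0 ≤ q) (hpN : 0 ≤ p + N)
    (hqN : 0 ≤ q + N) (hr : r = p + q + N - 1) {c d a : K} (ha : p ≠ q → a = 0) :
    h.ham N p c * h.ham N q d - h.ham N q d * h.ham N p c =
      hbarW K ι * (((p - q : ℤ) : K) • h.ham N r a) := by
  -- The constant of the target enters only with the factor `p - q`.
  have ha' : ((p : K) - q) * a = 0 := by
    rcases eq_or_ne p q with rfl | hpq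
    · rw [sub_self, zero_mul]
    · rw [ha hpq, mul_zero]
  refine Subtype.ext ?_
  change (h.ham N p c).1 * (h.ham N q d).1 - (h.ham N q d).1 * (h.ham N p c).1 =
    hbar K ι * (((p - q : ℤ) : K) • (h.ham N r a).1)
  simp only [ham_coe]
  -- Non-negative modes commute: `p = -q` forces `p = 0`.
  have e1 : J p * J q - J q * J p = 0 := by
    rw [h.commJ]
    split_ifs with hpq
    · obtain rfl : p = 0 := by lia
      rw [Int.cast_zero, zero_smul]
    · rfl
  have e2 := h.vir_commJ (p + N - 1) q
  have e3 := h.vir_commJ (q + N - 1) p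
  have e4 := h.vir_comm (m := p + N - 1) (n := q + N - 1) (by lia) (by lia)
  rw [show p + N - 1 + q = r by lia] at e2
  rw [show q + N - 1 + p = r by lia] at e3
  rw [show p + N - 1 + (q + N - 1) = r + N - 1 by lia] at e4
  have c1 := hbar_mul_What (h.memW p)
  have c2 := hbar_mul_What (h.memW q)
  have c3 := hbar_mul_What (h.vir (p + N - 1)).2
  have c4 := hbar_mul_What (h.vir (q + N - 1)).2
  push_cast at e4 ⊢
  rw [show (p : K) + N - 1 - (q + N - 1) = p - q by ring] at e4
  generalize (h.vir (p + N - 1)).1 = v at *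
  generalize (h.vir (q + N - 1)).1 = w at *
  generalize (h.vir (r + N - 1)).1 = u at *
  generalize J p = x at *
  generalize J q = y at *
  generalize J r = s at *
  generalize hbar K ι = t at *
  have e5 : (x + v + c • t) * (y + w + d • t) - (y + w + d • t) * (x + v + c • t) =
      (x * y - y * x) + (v * y - y * v) - (w * x - x * w) + (v * w - w * v) := by
    simp only [mul_add, add_mul, smul_mul_assoc, mul_smul_comm, c1, c2, c3, c4]
    module
  rw [e5, e1, e2, e3, e4, smul_add, smul_add, smul_smul, ha', zero_smul, add_zero, mul_add,
    mul_smul_comm, mul_smul_comm]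
  module

/-- Otherwise `ħL_{p+N-1}` would be a multiple of ħ and commute with the variable of index `p + N`,
whereas that commutator is `ħJ_{-1} ≠ 0`. -/
theorem ham_ne (h : IsModes b z J) {N p : ℤ} {a : ι} (ha : (z a : ℤ) = p + N) (c : K) :
    (h.ham N p c).1 ≠ J p := by
  intro h1
  rw [ham_coe, add_assoc, add_eq_left] at h1
  have h2 := h.vir_commX (p + N - 1) a
  rw [eq_neg_of_add_eq_zero_left h1, neg_mul, mul_neg, smul_mul_assoc, mul_smul_comm, hbar_mul_opX,
    sub_self, ha, show p + N - 1 - (p + N) = -1 by ring] at h2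
  have h3 : hbar K ι (J (-1) (mon K 0 0)) = 0 := (LinearMap.congr_fun h2 (mon K 0 0)).symm
  exact h.neg (hbar_injective (h3.trans (map_zero _).symm))

/-- Structure constants for a family that consists of the operators `H_i` for `i` in a set `G`, and
of operators that commute with the whole family. -/
theorem exists_structure_constants (h : IsModes b z J) {P : ι → What K ι} {N : ℤ} {G : Set ι}
    {d : ι → K} (hP : ∀ i ∈ G, P i = h.ham N (z i) (d i)) (hN : ∀ i ∈ G, 0 ≤ z i + N)
    (hc : ∀ i ∉ G, ∀ j, P i * P j = P j * P i)
    (ht : ∀ i ∈ G, ∀ j ∈ G, i ≠ j → ∃ k ∈ G, (z k : ℤ) = z i + z j + N - 1)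
    (hd : ∀ i ∈ G, ∀ j ∈ G, ∀ k, i ≠ j → (z k : ℤ) = z i + z j + N - 1 → d k = 0) :
    ∃ (c : ι → ι → K) (t : ι → ι → ι),
      (∀ i j, P i * P j - P j * P i = hbarW K ι * (c i j • P (t i j))) ∧
      ∀ k, {p : ι × ι | t p.1 p.2 = k ∧ c p.1 p.2 ≠ 0}.Finite := by
  classical
  -- Outside distinct pairs in `G` the target is the dummy value `i`; the structure constant there
  -- is zero.
  have ht' : ∀ i j, ∃ k, i ∈ G → j ∈ G → i ≠ j → k ∈ G ∧ (z k : ℤ) = z i + z j + N - 1 := by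
    intro i j
    by_cases hij : i ∈ G ∧ j ∈ G ∧ i ≠ j
    · obtain ⟨k, hk, hk'⟩ := ht i hij.1 j hij.2.1 hij.2.2
      exact ⟨k, fun _ _ _ => ⟨hk, hk'⟩⟩
    · exact ⟨i, fun h1 h2 h3 => absurd ⟨h1, h2, h3⟩ hij⟩
  choose t ht using ht'
  refine ⟨fun i j => if i ∈ G ∧ j ∈ G ∧ i ≠ j then (((z i : ℤ) - z j : ℤ) : K) else 0, t,
    fun i j => ?_, fun k => ?_⟩
  · simp only
    split_ifs with hij
    · obtain ⟨hi, hj, hij⟩ := hij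
      obtain ⟨hk, hk'⟩ := ht i j hi hj hij
      rw [hP i hi, hP j hj, hP _ hk]
      exact h.ham_comm (Int.natCast_nonneg _) (Int.natCast_nonneg _) (hN i hi) (hN j hj) hk'
        fun _ => hd i hi j hj _ hij hk'
    · rw [zero_smul, mul_zero, sub_eq_zero]
      by_cases hi : i ∈ G
      · by_cases hj : j ∈ G
        · obtain rfl : i = j := by
            by_contra h1
            exact hij ⟨hi, hj, h1⟩
          rfl
        · exact (hc j hj i).symm
      · exact hc i hi j
  · refine ((h.finite_index_lt (z k + 2 - N).toNat).prod
      (h.finite_index_lt (z k + 2 - N).toNat)).subset ?_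
    rintro ⟨i, j⟩ ⟨rfl, hij⟩
    obtain ⟨hi, hj, hij⟩ := (ite_ne_right_iff.1 hij).1
    obtain ⟨hk, hk'⟩ := ht i j hi hj hij
    refine ⟨?_, ?_⟩
    · change z i < _
      lia
    · change z j < _
      lia

theorem zero_mode_comm (h : IsModes b z J) (N p : ℤ) (c : K) :
    J 0 * (h.ham N p c).1 = (h.ham N p c).1 * J 0 := by
  have e1 := h.commJ 0 p
  have e2 := h.vir_commJ (p + N - 1) 0
  simp only [Int.cast_zero, zero_smul, ite_self, neg_zero, sub_eq_zero] at e1 e2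
  rw [ham_coe, mul_add, mul_add, add_mul, add_mul, e1, e2, mul_smul_comm, smul_mul_assoc,
    hbar_mul_What (h.memW 0)]

end IsModes

end Modes

/-! ### Verification of the mode axioms -/

section Boson

variable {K : Type*} [Field K] {ι : Type*}

theorem annihilation_mul (i j : ι) : (hpow K 1 * pd K i) * (hpow K 1 * pd K j) =
    (hpow K 1 * pd K j) * (hpow K 1 * pd K i) := by
  change hpow K 1 * (hpow K 1 * (pd K i * pd K j)) = hpow K 1 * (hpow K 1 * (pd K j * pd K i))
  rw [pd_mul_pd]

theorem creation_mul (i j : ι) : (hpow K (-1) * mulX K i) * (hpow K (-1) * mulX K j) =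
    (hpow K (-1) * mulX K j) * (hpow K (-1) * mulX K i) := by
  change hpow K (-1) * (hpow K (-1) * (mulX K i * mulX K j)) =
    hpow K (-1) * (hpow K (-1) * (mulX K j * mulX K i))
  rw [mulX_mul_mulX]

theorem annihilation_mul_creation [DecidableEq ι] (i j : ι) :
    (hpow K 1 * pd K i) * (hpow K (-1) * mulX K j) -
      (hpow K (-1) * mulX K j) * (hpow K 1 * pd K i) = if i = j then 1 else 0 := by
  have h1 : (hpow K 1 * pd K i) * (hpow K (-1) * mulX K j) = pd K i * mulX K j := by
    change (hpow K 1 * hpow K (-1)) * (pd K i * mulX K j) = _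
    rw [hpow_mul_hpow, show (1 + -1 : ℤ) = 0 by ring, hpow_zero, one_mul]
  have h2 : (hpow K (-1) * mulX K j) * (hpow K 1 * pd K i) = mulX K j * pd K i := by
    change (hpow K (-1) * hpow K 1) * (mulX K j * pd K i) = _
    rw [hpow_mul_hpow, show (-1 + 1 : ℤ) = 0 by ring, hpow_zero, one_mul]
  rw [h1, h2, pd_mul_mulX]

theorem hpow_hpow (m n : ℤ) (f : Raw K ι) : hpow K m (hpow K n f) = hpow K (m + n) f :=
  LinearMap.congr_fun (hpow_mul_hpow m n) f

theorem opX_vac_ne_zero (i : ι) : opX K i (mon K 0 0) ≠ 0 := by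
  classical
  intro h
  have h1 := congrArg (fun f : PS K ι => f.1 (0, Finsupp.single i 1)) h
  rw [opX_mon] at h1
  simp [mon_coeff] at h1

theorem hbar_opD_commX [DecidableEq ι] (i j : ι) :
    hbar K ι * opD K i * opX K j - opX K j * (hbar K ι * opD K i) =
      if i = j then hbar K ι else 0 := by
  have h1 : hbar K ι * opD K i * opX K j - opX K j * (hbar K ι * opD K i) =
      hbar K ι * (opD K i * opX K j - opX K j * opD K i) := by
    rw [mul_sub, ← mul_assoc, ← mul_assoc, ← mul_assoc, hbar_mul_opX]
  rw [h1, opD_mul_opX]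
  split_ifs
  exacts [mul_one _, mul_zero _]

theorem smul_opX_commX (c : K) (i j : ι) :
    (c • opX K i) * opX K j - opX K j * (c • opX K i) = 0 := by
  rw [smul_mul_assoc, mul_smul_comm, opX_mul_opX, sub_self]

/-- The three kinds of modes: annihilation operators, creation operators and a vanishing zero
mode. -/
inductive IsMode (z : ι → ℕ) : ℤ → Module.End K (Raw K ι) → Module.End K (PS K ι) → Prop
  | zero (h : ∀ i, z i ≠ 0) : IsMode z 0 0 0
  | annihilation (i : ι) : IsMode z (z i) (hpow K 1 * pd K i) (hbar K ι * opD K i)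
  | creation (i : ι) (hi : 0 < z i) :
    IsMode z (-z i) ((z i : K) • (hpow K (-1) * mulX K i)) ((z i : K) • opX K i)

theorem isHeisenberg_of_isMode {b : ℤ → Module.End K (Raw K ι)} {z : ι → ℕ}
    {J : ℤ → Module.End K (PS K ι)} (hz : Function.Injective z)
    (h : ∀ k, IsMode z k (b k) (J k)) : IsHeisenberg b := by
  classical
  -- Replacing `b m` and `b n` by variables allows a case analysis on the kind of each mode.
  have h' : ∀ k, ∃ A B, b k = A ∧ IsMode z k A B := fun k => ⟨_, J k, rfl, h k⟩
  intro m n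
  obtain ⟨A, A', hA, hA'⟩ := h' m
  obtain ⟨B, B', hB, hB'⟩ := h' n
  rw [hA, hB]
  clear hA hB
  rcases hA' with _ | i | ⟨i, hi⟩ <;> rcases hB' with _ | j | ⟨j, hj⟩
  · simp
  · simp
  · simp
  · rw [mul_zero, zero_mul, sub_zero]
    split_ifs with hij
    · simp [hij]
    · rfl
  · rw [annihilation_mul, sub_self]
    split_ifs with hij
    · obtain h0 : z i = 0 := by lia
      simp [h0]
    · rfl
  · rw [mul_smul_comm, smul_mul_assoc, ← smul_sub, annihilation_mul_creation]
    by_cases hij : i = j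
    · subst hij
      simp
    · rw [if_neg hij, if_neg, smul_zero]
      rw [neg_neg]
      exact_mod_cast fun h => hij (hz h)
  · rw [mul_zero, zero_mul, sub_zero, if_neg (by lia)]
  · rw [mul_smul_comm, smul_mul_assoc, ← smul_sub, ← neg_sub, annihilation_mul_creation]
    by_cases hij : i = j
    · subst hij
      simp
    · rw [if_neg (Ne.symm hij), if_neg, neg_zero, smul_zero]
      rw [neg_inj]
      exact_mod_cast fun h => hij (hz h)
  · rw [smul_mul_smul_comm, smul_mul_smul_comm, creation_mul, mul_comm (z i : K), sub_self,
      if_neg (by lia)]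

theorem isModes_of_isMode {b : ℤ → Module.End K (Raw K ι)} {z : ι → ℕ}
    {J : ℤ → Module.End K (PS K ι)} (hz : Function.Injective z)
    (h : ∀ k, IsMode z k (b k) (J k)) : IsModes b z J where
  inj := hz
  val k f := by
    generalize b k = A, J k = B, h k = hk
    rcases hk with _ | i | ⟨i, hi⟩
    · rfl
    · exact (hpow_hpow 1 1 (pd K i f.1)).symm
    · have h1 := hpow_hpow 1 (-1) ((z i : K) • mulX K i f.1)
      rw [add_neg_cancel, hpow_zero] at h1
      exact h1.symm
  comm k := by
    generalize b k = A, J k = B, h k = hk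
    rcases hk with _ | i | ⟨i, hi⟩
    · rfl
    · rfl
    · rw [mul_smul_comm, smul_mul_assoc, ← mul_assoc, hpow_mul_hpow, add_comm, ← hpow_mul_hpow]
      rfl
  heis := isHeisenberg_of_isMode hz h
  mem k := by
    generalize b k = A, J k = B, h k = hk
    rcases hk with _ | i | ⟨i, hi⟩
    · exact zero_mem _
    · exact hbar_opD_mem_weyl _
    · exact (weyl K ι).smul_mem (opX_mem_weyl _) _
  pos i := by
    -- The index must be a variable for the case analysis.
    obtain ⟨k, hk⟩ : ∃ k : ℤ, k = z i := ⟨_, rfl⟩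
    rw [← hk]
    generalize b k = A, J k = B, h k = hk'
    rcases hk' with h0 | j | ⟨j, hj⟩
    · exact absurd (by exact_mod_cast hk.symm) (h0 i)
    · rw [hz (Nat.cast_injective hk)]
    · lia
  tail f n := by
    obtain ⟨s, hs⟩ := exists_opD_mem_filt f n
    refine ⟨s.sup z + 1, fun k hk => ?_⟩
    generalize b k = A, J k = B, h k = hk'
    rcases hk' with _ | i | ⟨i, hi⟩
    · exact zero_mem _
    · refine weyl_filt hbar_mem_weyl n (hs _ fun hi => ?_)
      have : z i ≤ s.sup z := Finset.le_sup hi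
      lia
    · lia
  vac k hk := by
    generalize b k = A, J k = B, h k = hk'
    rcases hk' with _ | i | ⟨i, hi⟩
    · rfl
    · rw [Module.End.mul_apply, opD_mon_zero, map_zero]
    · lia
  commX k a := by
    classical
    generalize b k = A, J k = B, h k = hk
    rcases hk with h0 | i | ⟨i, hi⟩
    · rw [zero_mul, mul_zero, sub_zero, if_neg]
      exact_mod_cast (h0 a).symm
    · rw [hbar_opD_commX]
      refine if_congr ?_ rfl rfl
      rw [Nat.cast_inj, hz.eq_iff]
    · rw [smul_opX_commX, if_neg (by lia)]
  deg k := by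
    generalize b k = A, J k = B, h k = hk
    rcases hk with _ | i | ⟨i, hi⟩
    · exact DegIn.zero
    · exact degIn_hbar_opD _
    · exact (degIn_opX _).smul _
  neg := by
    obtain ⟨k, hk⟩ : ∃ k : ℤ, k = -1 := ⟨_, rfl⟩
    rw [← hk]
    generalize b k = A, J k = B, h k = hk'
    rcases hk' with _ | i | ⟨i, hi⟩
    · lia
    · lia
    · rw [show z i = 1 by lia, Nat.cast_one, one_smul]
      exact opX_vac_ne_zero i

end Boson

/-! ### The bosonic modes with and without zero mode -/

section Instances

variable (K : Type*) [Field K]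

/-- The operators `√ħ b_k` on `K[[V, ħ]]`. -/
noncomputable def bosonPS (k : ℤ) : Module.End K (PS K ℕ) :=
  if 0 ≤ k then hbar K ℕ * opD K k.toNat else ((-k : ℤ) : K) • opX K (-k).toNat

/-- The operators `√ħ b_k` on `K[[V_red, ħ]]`. -/
noncomputable def bosonRedPS : ℤ → Module.End K (PS K ℕ+)
  | 0 => 0
  | Int.ofNat (k + 1) => hbar K ℕ+ * opD K k.succPNat
  | Int.negSucc k => ((k : K) + 1) • opX K k.succPNat

theorem isMode_boson (k : ℤ) : IsMode id k (boson K k) (bosonPS K k) := by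
  rcases le_or_gt 0 k with hk | hk
  · rw [boson, bosonPS, if_pos hk, if_pos hk]
    lift k to ℕ using hk
    exact .annihilation k
  · rw [boson, bosonPS, if_neg (not_le.2 hk), if_neg (not_le.2 hk)]
    obtain ⟨n, rfl⟩ : ∃ n : ℕ, k = -n := ⟨(-k).toNat, by lia⟩
    rw [neg_neg, Int.toNat_natCast, Int.cast_natCast]
    exact .creation n (by simp only [id]; lia)

theorem isMode_bosonRed (k : ℤ) :
    IsMode (fun i : ℕ+ => (i : ℕ)) k (bosonRed K k) (bosonRedPS K k) := by
  rcases k with (_ | k) | k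
  · exact .zero fun i => i.ne_zero
  · exact .annihilation k.succPNat
  · have h : IsMode (fun i : ℕ+ => (i : ℕ)) (-((k.succPNat : ℕ) : ℤ))
        (((k.succPNat : ℕ) : K) • (hpow K (-1) * mulX K k.succPNat))
        (((k.succPNat : ℕ) : K) • opX K k.succPNat) := .creation k.succPNat k.succPNat.pos
    rw [Nat.succPNat_coe, Nat.cast_succ (R := K)] at h
    exact h

theorem isModes_boson : IsModes (boson K) id (bosonPS K) :=
  isModes_of_isMode Function.injective_id (isMode_boson K)

theorem isModes_bosonRed : IsModes (bosonRed K) (fun i : ℕ+ => (i : ℕ)) (bosonRedPS K) :=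
  isModes_of_isMode PNat.coe_injective (isMode_bosonRed K)

end Instances

/-! ### The operators of the three classes -/

section Classes

variable {K : Type*} [Field K] {ι : Type*} {b : ℤ → Module.End K (Raw K ι)}
  {z : ι → ℕ} {J : ℤ → Module.End K (PS K ι)}

theorem trunc_eq_zero {D : ℕ → K} {R : ℤ} {i : ℕ} (h : R < i) : trunc D R i = 0 :=
  if_neg (not_le.2 h)

/-- The operators of the second class. -/
noncomputable def secondFamily (K : Type*) [Field K] (N : ℤ) (C₀ : K) (D : ℕ → K) (i : ℕ) :
    What K ℕ :=
  if i = 0 then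
    ⟨bosonPS K 0, (isModes_boson K).memW 0⟩ +
      (C₀ / 2) • (⟨bosonPS K 0, (isModes_boson K).memW 0⟩ *
        ⟨bosonPS K 0, (isModes_boson K).memW 0⟩) + D 0 • hbarW K ℕ
  else (isModes_boson K).ham N i (trunc D (N + 1) i)

theorem secondFamily_of_ne (N : ℤ) (C₀ : K) (D : ℕ → K) {i : ℕ} (hi : i ≠ 0) :
    secondFamily K N C₀ D i = (isModes_boson K).ham N i (trunc D (N + 1) i) := if_neg hi

theorem secondFamily_zero_coe (N : ℤ) (C₀ : K) (D : ℕ → K) :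
    (secondFamily K N C₀ D 0).1 = bosonPS K 0 + (C₀ / 2) • (bosonPS K 0 * bosonPS K 0) +
      D 0 • hbar K ℕ := rfl

theorem secondFamily_val (N : ℤ) (C₀ : K) (D : ℕ → K) (i : ℕ) (f : PS K ℕ) :
    ((secondFamily K N C₀ D i).1 f).1 = classTwo N C₀ D i f.1 := by
  rcases eq_or_ne i 0 with rfl | hi
  · rw [secondFamily_zero_coe, classTwo, if_pos rfl]
    have h0 : bosonPS K 0 = hbar K ℕ * opD K 0 := (isModes_boson K).pos 0
    rw [h0]
    refine congrArg₂ (· + ·) (congrArg₂ (· + ·) rfl ?_) rfl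
    change (C₀ / 2) • hpow K 2 (hpow K 2 (pd K 0 (pd K 0 f.1))) = _
    rw [hpow_hpow]
    rfl
  · rw [secondFamily_of_ne N C₀ D hi, classTwo, if_neg hi]
    exact (isModes_boson K).ham_val N i _ f

variable [CharZero K]

/-- Families that consist of the operators `H_i` for `i ∈ G`, where `G` contains all but finitely
many indices, and of operators that commute with the whole family. -/
theorem IsModes.isQuantumAiry (h : IsModes b z J) {P : ι → What K ι} {N : ℤ} {G : Set ι}
    {d : ι → K} {R : ℕ} (hP : ∀ i ∈ G, P i = h.ham N (z i) (d i)) (hN : ∀ i ∈ G, 0 ≤ z i + N)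
    (hR : ∀ i, R ≤ z i → i ∈ G ∧ d i = 0)
    (hc : ∀ i ∉ G, ∀ j, P i * P j = P j * P i)
    (hdeg : ∀ i ∉ G, DegIn {1, 2} (P i).1)
    (hlin : ∀ i ∉ G, lowPart 1 (P i).1 = hbar K ι * opD K i)
    (ht : ∀ i ∈ G, ∀ j ∈ G, i ≠ j → ∃ k ∈ G, (z k : ℤ) = z i + z j + N - 1)
    (hd : ∀ i ∈ G, ∀ j ∈ G, ∀ k, i ≠ j → (z k : ℤ) = z i + z j + N - 1 → d k = 0)
    (hne : ∃ i ∈ G, ∃ a, (z a : ℤ) = z i + N)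
    {L : DualV K ι →ₗ[K] What K ι} (hL : IsCont L) (hLP : ∀ i, L (y K i) = P i) :
    IsQuantumAiry L ∧ IsQuadratic L ∧ IsSubalgebraic L := by
  obtain ⟨c, t, hbr, hfin⟩ := h.exists_structure_constants hP hN hc ht hd
  refine isQuantumAiry_of_family (h.ptSummable_ham (N := N) (R := R) fun i hi => ?_) (fun i => ?_)
    (fun i => ?_) ?_ hbr hfin hL hLP
  · rw [hP i (hR i hi).1, (hR i hi).2]
  · by_cases hi : i ∈ G
    · rw [hP i hi]
      exact h.ham_degIn _ _ _
    · exact hdeg i hi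
  · by_cases hi : i ∈ G
    · rw [hP i hi, h.lowPart_ham, h.pos]
    · exact hlin i hi
  · obtain ⟨i, hi, a, ha⟩ := hne
    refine ⟨i, ?_⟩
    rw [hP i hi, ← h.pos]
    exact h.ham_ne ha _

/-- The operators `H_i + ħ D_i δ_{i ≤ R}`. -/
noncomputable def IsModes.truncFamily (h : IsModes b z J) (N : ℤ) (D : ℕ → K) (R : ℤ) (i : ι) :
    What K ι :=
  h.ham N (z i) (trunc D R (z i))

theorem IsModes.truncFamily_comm (h : IsModes b z J) {N R : ℤ} (D : ℕ → K) {i j k : ι}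
    (hi : 0 ≤ z i + N) (hj : 0 ≤ z j + N) (hk : (z k : ℤ) = z i + z j + N - 1)
    (hR : i ≠ j → R < z k) :
    BracketEq (h.truncFamily N D R i) (h.truncFamily N D R j) ((z i : ℤ) - z j)
      (h.truncFamily N D R k) :=
  h.ham_comm (Int.natCast_nonneg _) (Int.natCast_nonneg _) hi hj hk
    fun hij => trunc_eq_zero (hR fun h1 => hij (by rw [h1]))

/-- The operator of index 0 is a polynomial in `J_0` and ħ, and both commute with every `H_i`, as
`[ħL_m, J_0] = 0`. -/
theorem secondFamily_comm (N : ℤ) (C₀ : K) (D : ℕ → K) (i : ℕ) :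
    secondFamily K N C₀ D 0 * secondFamily K N C₀ D i =
      secondFamily K N C₀ D i * secondFamily K N C₀ D 0 := by
  rcases eq_or_ne i 0 with rfl | hi
  · rfl
  refine Subtype.ext ?_
  change (secondFamily K N C₀ D 0).1 * (secondFamily K N C₀ D i).1 =
    (secondFamily K N C₀ D i).1 * (secondFamily K N C₀ D 0).1
  rw [secondFamily_zero_coe, secondFamily_of_ne N C₀ D hi]
  have h1 := (isModes_boson K).zero_mode_comm N i (trunc D (N + 1) i)
  have h2 := hbar_mul_What ((isModes_boson K).ham N i (trunc D (N + 1) i)).2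
  rw [mul_add, mul_add, add_mul, add_mul, smul_mul_assoc, mul_smul_comm, smul_mul_assoc,
    mul_smul_comm, mul_assoc, h1, h2, ← mul_assoc, h1, mul_assoc]

end Classes

end Airy

/-! ### Proof of the proposition -/

open Airy
theorem mainTheorem6 {K : Type*} [RCLike K] :
    -- the modes represent the Heisenberg algebra
    IsHeisenberg (boson K) ∧ IsHeisenberg (bosonRed K) ∧
    -- the operators `H_i` represent the Virasoro subalgebra
    (∀ N : ℤ, -1 ≤ N → ∃ H : ℕ → What K ℕ,
      (∀ (i : ℕ) (f : PS K ℕ), ((H i).1 f).1 = hamiltonian (boson K) N i i f.1) ∧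
      ∀ i j k : ℕ, (0 ≤ N ∨ (1 ≤ i ∧ 1 ≤ j)) → (k : ℤ) = i + j + N - 1 →
        BracketEq (H i) (H j) ((i : ℤ) - j) (H k)) ∧
    -- first class
    (∀ (N : ℤ) (D : ℕ → K), 0 ≤ N →
      (∃! H : DualV K ℕ →ₗ[K] What K ℕ, IsGivenBy (classOne N D) H) ∧
      ∀ H : DualV K ℕ →ₗ[K] What K ℕ, IsGivenBy (classOne N D) H →
        IsQuantumAiry H ∧ IsQuadratic H ∧ IsSubalgebraic H ∧
        ∀ i j k : ℕ, (k : ℤ) = i + j + N - 1 →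
          BracketEq (H (y K i)) (H (y K j)) ((i : ℤ) - j) (H (y K k))) ∧
    -- second class
    (∀ (N : ℤ) (C₀ : K) (D : ℕ → K), -1 ≤ N →
      (∃! H : DualV K ℕ →ₗ[K] What K ℕ, IsGivenBy (classTwo N C₀ D) H) ∧
      ∀ H : DualV K ℕ →ₗ[K] What K ℕ, IsGivenBy (classTwo N C₀ D) H →
        IsQuantumAiry H ∧ IsQuadratic H ∧ IsSubalgebraic H ∧
        (∀ i j k : ℕ, 1 ≤ i → 1 ≤ j → (k : ℤ) = i + j + N - 1 →
          BracketEq (H (y K i)) (H (y K j)) ((i : ℤ) - j) (H (y K k))) ∧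
        ∀ i : ℕ, 1 ≤ i → H (y K 0) * H (y K i) - H (y K i) * H (y K 0) = 0) ∧
    -- third class
    (∀ (N : ℤ) (D : ℕ → K), -1 ≤ N →
      (∃! H : DualV K ℕ+ →ₗ[K] What K ℕ+, IsGivenBy (classThree N D) H) ∧
      ∀ H : DualV K ℕ+ →ₗ[K] What K ℕ+, IsGivenBy (classThree N D) H →
        IsQuantumAiry H ∧ IsQuadratic H ∧ IsSubalgebraic H ∧
        ∀ i j k : ℕ+, ((k : ℕ) : ℤ) = (i : ℕ) + (j : ℕ) + N - 1 →
          BracketEq (H (y K i)) (H (y K j)) (((i : ℕ) : ℤ) - (j : ℕ)) (H (y K k))) := by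
  have hb := isModes_boson K
  have hr := isModes_bosonRed K
  refine ⟨hb.heis, hr.heis, fun N hN => ?_, fun N D hN => ?_, fun N C₀ D hN => ?_,
    fun N D hN => ?_⟩
  · refine ⟨fun i => hb.ham N i 0, fun i f => ?_, fun i j k hij hk => ?_⟩
    · have h1 := hb.ham_val N i 0 f
      rwa [zero_smul, map_zero, add_zero] at h1
    · exact hb.ham_comm (by lia) (by lia) (by lia) (by lia) hk fun _ => rfl
  · have hQ : ∀ i (f : PS K ℕ), ((hb.truncFamily N D (N - 1) i).1 f).1 = classOne N D i f.1 :=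
      fun i f => hb.ham_val N i _ f
    refine ⟨existsUnique_isGivenBy hQ (hb.ptSummable_ham (N := N) (R := N.toNat) fun i hi => ?_),
      fun H hH => ?_⟩
    · exact congrArg _ (trunc_eq_zero (by simp only [id] at hi ⊢; lia))
    · obtain ⟨hL, hLP⟩ := (isGivenBy_iff hQ).1 hH
      obtain ⟨h1, h2, h3⟩ := hb.isQuantumAiry (R := N.toNat) (G := Set.univ)
        (fun i _ => rfl) (fun i _ => by lia)
        (fun i hi => ⟨trivial, trunc_eq_zero (by simp only [id] at hi ⊢; lia)⟩)
        (fun i hi => absurd trivial hi) (fun i hi => absurd trivial hi)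
        (fun i hi => absurd trivial hi)
        (fun i _ j _ hij => ⟨(i + j + N - 1).toNat, trivial, by simp only [id]; lia⟩)
        -- Distinct `i, j ≥ 0` have `i + j ≥ 1`, so the target is at least `N`, beyond the last
        -- constant.
        (fun i _ j _ k hij hk => trunc_eq_zero (by simp only [id] at hk ⊢; lia))
        ⟨0, trivial, N.toNat, by simp only [id]; lia⟩ hL hLP
      refine ⟨h1, h2, h3, fun i j k hk => ?_⟩
      rw [hLP, hLP, hLP]
      exact hb.truncFamily_comm D (by lia) (by lia) hk fun hij => by simp only [id]; lia
  · have hQ := secondFamily_val N C₀ D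
    refine ⟨existsUnique_isGivenBy hQ (hb.ptSummable_ham (N := N) (R := (N + 2).toNat + 1)
      fun i hi => ?_), fun H hH => ?_⟩
    · simp only [id] at hi ⊢
      rw [secondFamily_of_ne N C₀ D (by lia), trunc_eq_zero (by lia)]
    · obtain ⟨hL, hLP⟩ := (isGivenBy_iff hQ).1 hH
      have hG : ∀ i : ℕ, i ∉ {i : ℕ | i ≠ 0} → i = 0 := fun i hi => not_not.1 hi
      obtain ⟨h1, h2, h3⟩ := hb.isQuantumAiry (N := N) (R := (N + 2).toNat + 1)
        (G := {i : ℕ | i ≠ 0}) (P := secondFamily K N C₀ D) (d := fun i => trunc D (N + 1) i)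
        (fun i hi => secondFamily_of_ne N C₀ D hi)
        (fun i (hi : i ≠ 0) => by simp only [id]; lia)
        (fun i hi => ⟨show i ≠ 0 by simp only [id] at hi; lia,
          trunc_eq_zero (by simp only [id] at hi ⊢; lia)⟩)
        (fun i hi j => by rw [hG i hi]; exact secondFamily_comm N C₀ D j)
        (fun i hi => by
          rw [hG i hi, secondFamily_zero_coe]
          exact (((hb.deg 0).mono (by simp)).add ((((hb.deg 0).mul (hb.deg 0)).smul _).mono
            (by simp))).add ((degIn_hbar.smul _).mono (by simp)))
        (fun i hi => by
          rw [hG i hi, secondFamily_zero_coe, lowPart_add, lowPart_add,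
            lowPart_eq_self ((hb.deg 0).mono (by simp)),
            lowPart_eq_zero (((hb.deg 0).mul (hb.deg 0)).smul _) (by simp),
            lowPart_eq_zero (degIn_hbar.smul _) (by simp), add_zero, add_zero]
          exact hb.pos 0)
        (fun i (hi : i ≠ 0) j (hj : j ≠ 0) hij => ⟨(i + j + N - 1).toNat,
          show (i + j + N - 1).toNat ≠ 0 by lia, by simp only [id]; lia⟩)
        -- Distinct `i, j ≥ 1` have `i + j ≥ 3`, so the target is at least `N + 2`.
        (fun i (hi : i ≠ 0) j (hj : j ≠ 0) k hij hk =>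
          trunc_eq_zero (by simp only [id] at hk ⊢; lia))
        ⟨1, one_ne_zero, (N + 1).toNat, by simp only [id]; lia⟩ hL hLP
      refine ⟨h1, h2, h3, fun i j k hi hj hk => ?_, fun i hi => ?_⟩
      · rw [hLP, hLP, hLP]
        -- For `N = -1` and `i = j = 1` the target is 0, whose operator is not an `H_k`; the
        -- relation is then `0 = 0`.
        rcases eq_or_ne i j with rfl | hij
        · rw [BracketEq, sub_self, sub_self, Int.cast_zero, zero_smul, mul_zero]
        · rw [secondFamily_of_ne N C₀ D (by lia), secondFamily_of_ne N C₀ D (by lia),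
            secondFamily_of_ne N C₀ D (by lia)]
          exact hb.ham_comm (by lia) (by lia) (by lia) (by lia) hk fun _ => trunc_eq_zero (by lia)
      · rw [hLP, hLP, secondFamily_comm, sub_self]
  · have hQ : ∀ i (f : PS K ℕ+), ((hr.truncFamily N D (N + 1) i).1 f).1 = classThree N D i f.1 :=
      fun i f => hr.ham_val N i _ f
    refine ⟨existsUnique_isGivenBy hQ (hr.ptSummable_ham (N := N) (R := (N + 2).toNat) fun i hi => ?_),
      fun H hH => ?_⟩
    · exact congrArg _ (trunc_eq_zero (by lia))
    · obtain ⟨hL, hLP⟩ := (isGivenBy_iff hQ).1 hH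
      have hpos : ∀ i : ℕ+, 0 < (i : ℕ) := PNat.pos
      have hex : ∀ m : ℤ, 0 < m → ∃ k : ℕ+, ((k : ℕ) : ℤ) = m := fun m hm =>
        ⟨⟨m.toNat, by lia⟩, by simp only [PNat.mk_coe]; lia⟩
      have hne : ∀ i j : ℕ+, i ≠ j → (i : ℕ) ≠ j := fun i j h h' => h (PNat.coe_injective h')
      obtain ⟨h1, h2, h3⟩ := hr.isQuantumAiry (R := (N + 2).toNat) (G := Set.univ)
        (fun i _ => rfl) (fun i _ => by have := hpos i; lia)
        (fun i hi => ⟨trivial, trunc_eq_zero (by lia)⟩)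
        (fun i hi => absurd trivial hi) (fun i hi => absurd trivial hi)
        (fun i hi => absurd trivial hi)
        (fun i _ j _ hij => by
          have h1 := hpos i
          have h2 := hpos j
          have h3 := hne i j hij
          obtain ⟨k, hk⟩ := hex ((i : ℕ) + (j : ℕ) + N - 1) (by lia)
          exact ⟨k, trivial, hk⟩)
        (fun i _ j _ k hij hk => trunc_eq_zero (by
          have h1 := hpos i
          have h2 := hpos j
          have h3 := hne i j hij
          lia))
        (by
          obtain ⟨a, ha⟩ := hex (2 + N) (by lia)
          -- Index 2 rather than 1: `1 + N` may be 0, which is not the index of a variable here.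
          exact ⟨2, trivial, a, ha⟩) hL hLP
      refine ⟨h1, h2, h3, fun i j k hk => ?_⟩
      have h1 := hpos i
      have h2 := hpos j
      rw [hLP, hLP, hLP]
      exact hr.truncFamily_comm D (by lia) (by lia) hk fun hij => by
        have h3 := hne i j hij
        lia
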